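/- For $n\ge 1$ let $\mathcal T_n$ be the set of trees with vertex set $[n]=\{1,\dots,n\}$, let $\boldsymbol T$ be a uniform random element of $\mathcal T_n$, and fix a root vertex $r\in[n]$. For $T\in\mathcal T_n$ rooted at $r$, a branch of $T$ at a vertex $i$ is the fringe subtree (a vertex with all its descendants, rooted at that vertex) at a child of $i$. For a rooted unlabelled tree $B$, let $N_i(B,T,r)$ be the number of branches of $T$ at $i$ isomorphic to $B$ as rooted trees. A branch, or a rooted unlabelled tree, is small if it has at most $4\log n$ vertices and large otherwise. Let $\mathrm{Aut}_{\rm small}(T)$ be the group of automorphisms of $T$ that fix $r$ and every vertex that is the root of a large branch, and let $F(T):=\log|\mathrm{Aut}_{\rm small}(T)|$. Then for all $n\ge1$, $r\in[n]$ and $T\in\mathcal T_n$, $$F(T)=\sum_{i\in[n]}\ \sum_{B\ \text{small}}\log\bigl(N_i(B,T,r)!\bigr),$$ where the inner sum is over all small rooted unlabelled trees $B$. Moreover, there is $n_0$ such that for all $n\ge n_0$ and all $r\in[n]$, $$\operatorname{Var}F(\boldsymbol T)\ \ge\ 0.002\,n .$$ -/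

import Mathlib

open MeasureTheory ProbabilityTheory Filter

/-- The set of trees whose vertices are labelled by `Fin n`. -/
def LabelledTree (n : ℕ) : Type := {G : SimpleGraph (Fin n) // G.IsTree}

/-- The underlying graph of a labelled tree. -/
def LabelledTree.graph {n : ℕ} (T : LabelledTree n) : SimpleGraph (Fin n) := T.1

theorem LabelledTree.isTree {n : ℕ} (T : LabelledTree n) : T.graph.IsTree := T.2

instance (n : ℕ) : Finite (LabelledTree n) :=
  inferInstanceAs (Finite {G : SimpleGraph (Fin n) // G.IsTree})

/-- Every set of labelled trees is an event. -/
instance (n : ℕ) : MeasurableSpace (LabelledTree n) := ⊤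

/-- The law of the uniform random labelled tree on `n` vertices. -/
noncomputable def uniformTree (n : ℕ) : Measure (LabelledTree n) := uniformOn Set.univ

/-- A rooted tree with vertex set `Fin m`. -/
structure LabelledRootedTree (m : ℕ) where
  /-- the tree -/
  graph : SimpleGraph (Fin m)
  /-- the root -/
  root : Fin m
  isTree : graph.IsTree

theorem LabelledRootedTree.toProd_injective (m : ℕ) :
    Function.Injective (fun B : LabelledRootedTree m => (B.graph, B.root)) := by
  rintro ⟨G, r, hG⟩ ⟨H, s, hH⟩ h
  simp only [Prod.mk.injEq] at h
  obtain ⟨rfl, rfl⟩ := h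
  rfl

instance (m : ℕ) : Finite (LabelledRootedTree m) :=
  Finite.of_injective _ (LabelledRootedTree.toProd_injective m)

/-- Two rooted graphs are isomorphic if some graph isomorphism maps root to root. -/
def RootedIso {V W : Type} (G : SimpleGraph V) (r : V) (H : SimpleGraph W) (s : W) : Prop :=
  ∃ e : G ≃g H, e r = s

/-- Isomorphism of rooted trees on `m` vertices. -/
instance rootedTreeSetoid (m : ℕ) : Setoid (LabelledRootedTree m) where
  r B C := RootedIso B.graph B.root C.graph C.root
  iseqv :=
    { refl := fun _ => ⟨SimpleGraph.Iso.refl, rfl⟩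
      symm := by
        rintro B C ⟨e, he⟩
        exact ⟨e.symm, by rw [← he]; exact e.symm_apply_apply _⟩
      trans := by
        rintro B C D ⟨e, he⟩ ⟨f, hf⟩
        exact ⟨e.trans f, by rw [← hf, ← he]; rfl⟩ }

/-- Rooted unlabelled trees with `m` vertices: isomorphism classes of rooted trees. -/
def UnlabelledRootedTree (m : ℕ) : Type := Quotient (rootedTreeSetoid m)

instance (m : ℕ) : Finite (UnlabelledRootedTree m) :=
  inferInstanceAs (Finite (Quotient (rootedTreeSetoid m)))

noncomputable instance (m : ℕ) : Fintype (UnlabelledRootedTree m) := Fintype.ofFinite _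

namespace LabelledTree

variable {n : ℕ}

/-- The vertex set of the fringe subtree of `T` at `v` with respect to the root `r`: all `u` such
that the path from `r` to `u` passes through `v` (in particular, `v` itself). -/
def descendants (T : LabelledTree n) (r v : Fin n) : Set (Fin n) :=
  {u | ∃ p : T.graph.Walk r u, p.IsPath ∧ v ∈ p.support}

/-- `v` is an immediate descendant (a child) of `i` with respect to the root `r`. -/
def IsChild (T : LabelledTree n) (r i v : Fin n) : Prop :=
  T.graph.Adj i v ∧ v ∈ T.descendants r i

theorem self_mem_descendants (T : LabelledTree n) (r v : Fin n) : v ∈ T.descendants r v := by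
  obtain ⟨p, hp⟩ := (T.isTree.connected r v).exists_isPath
  exact ⟨p, hp, p.end_mem_support⟩

/-- The fringe subtree of `T` at `v`, rooted at `v`, has isomorphism class `B`. -/
def HasBranchType (T : LabelledTree n) (r v : Fin n) {m : ℕ} (B : UnlabelledRootedTree m) : Prop :=
  ∃ C : LabelledRootedTree m, (Quotient.mk _ C : Quotient (rootedTreeSetoid m)) = B ∧
    RootedIso (T.graph.induce (T.descendants r v)) ⟨v, T.self_mem_descendants r v⟩ C.graph C.root

/-- The number `N_i(B, T, r)` of branches of `T` at `i`, i.e. fringe subtrees at children of `i`,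
that are isomorphic to `B`. -/
noncomputable def branchCount (T : LabelledTree n) (r i : Fin n) {m : ℕ}
    (B : UnlabelledRootedTree m) : ℕ :=
  {v : Fin n | T.IsChild r i v ∧ T.HasBranchType r v B}.ncard

/-- `v` is the root of a large branch: it is a child of some vertex and the fringe subtree at `v`
has more than `4 log n` vertices. -/
def IsLargeBranchRoot (T : LabelledTree n) (r v : Fin n) : Prop :=
  (∃ i, T.IsChild r i v) ∧ 4 * Real.log n < ((T.descendants r v).ncard : ℝ)

/-- The group of small automorphisms: the automorphisms of `T` that fix the root `r` and
every vertex that is the root of a large branch. -/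
def autSmall (T : LabelledTree n) (r : Fin n) : Subgroup (T.graph ≃g T.graph) where
  carrier := {σ | σ r = r ∧ ∀ v, T.IsLargeBranchRoot r v → σ v = v}
  one_mem' := ⟨rfl, fun _ _ => rfl⟩
  mul_mem' := by
    rintro σ τ ⟨hσ, hσ'⟩ ⟨hτ, hτ'⟩
    refine ⟨?_, fun v hv => ?_⟩
    · rw [RelIso.mul_apply, hτ, hσ]
    · rw [RelIso.mul_apply, hτ' v hv, hσ' v hv]
  inv_mem' := by
    rintro σ ⟨hσ, hσ'⟩
    refine ⟨?_, fun v hv => ?_⟩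
    · conv_lhs => rw [← hσ]
      exact RelIso.inv_apply_self σ r
    · conv_lhs => rw [← hσ' v hv]
      exact RelIso.inv_apply_self σ v

/-- The truncated log-automorphism parameter `F(T) = log |Aut_small(T)|`, for the root `r`. -/
noncomputable def logAutSmall (r : Fin n) (T : LabelledTree n) : ℝ :=
  Real.log (Nat.card (T.autSmall r))

end LabelledTree

/-! ### Rooted trees encoded by parent functions. -/

section ParentFunctions

variable {V : Type} {W S : Finset V} {r u v w x y : V} {p q : V → V}

/-! The formula for `logAutSmall` is an iterated orbit–stabilizer count. The vertices required to be
fixed form a set closed under parents. Fix the remaining vertices one at a time, each after its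
parent: the possible images of a vertex are its not yet fixed siblings with an isomorphic branch, so
each class of isomorphic small branches at a vertex contributes a factorial (`card_fixingPerms`,
`logAutSmall_eq`).

The variance bound is Cauchy–Schwarz against a test statistic. Bend a fringe subtree that is a path
v - a - b into a cherry at v with leaves a, b. This is a bijection from pairs (tree, path) to pairs
(tree, ordered cherry). Hence, for S = `slotBalance`, the number of ordered cherries minus the
number of paths, the sum of G·S over all trees equals the sum over all pairs (tree, path) of the
increment of G under bending (`sum_mul_slotBalance`). Let P = `pathTotal n` be the number of such
pairs.

Bending raises S by 3, so the sum of S² is 3P. It raises F by log 2 at v; F can drop only at the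
parent of a vertex u equal to v or an ancestor of v, and there by at most log 2 for each twin of u,
that is, each sibling with an isomorphic branch (`logAutSmall_bendPath`). Twins are rare: a tree
with a twin branch of k vertices is recovered from the tree without that branch and the list of
deleted vertices, which leaves at most P/2^k configurations. As k ≥ 3, there are at most P/4 in all
(`four_mul_sum_card_twins_le`).

So the sum of (F - EF)·S is at least (3/4)·log 2·P, and Cauchy–Schwarz makes the sum of (F - EF)² at
least (3/16)(log 2)²·P > 0.09 P. By Cayley's formula P divided by the number of trees is
asymptotically n/e³, eventually at least n/40, and 0.09/40 > 0.002. In the variance bound the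
truncation matters only in that a single leaf must be small. -/

/-- `p` is the parent function of a tree with vertex set `W` and root `r`; the root and the points
outside `W` are fixed. -/
structure IsParentFun (W : Finset V) (r : V) (p : V → V) : Prop where
  root_mem : r ∈ W
  root : p r = r
  off : ∀ v ∉ W, p v = v
  reach : ∀ v ∈ W, ∃ k, p^[k] v = r

/-- `x` is a descendant of `v` (possibly `v` itself) for the parent function `p`. -/
def IsBelow (p : V → V) (v x : V) : Prop := ∃ k, p^[k] x = v

theorem IsBelow.refl (p : V → V) (v : V) : IsBelow p v v := ⟨0, rfl⟩

theorem IsBelow.trans (h : IsBelow p u v) (h' : IsBelow p v w) : IsBelow p u w := by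
  obtain ⟨i, rfl⟩ := h
  obtain ⟨j, rfl⟩ := h'
  exact ⟨i + j, Function.iterate_add_apply p i j w⟩

theorem isBelow_parent (p : V → V) (x : V) : IsBelow p (p x) x := ⟨1, rfl⟩

theorem IsBelow.parent_of_ne (h : IsBelow p v x) (hx : x ≠ v) : IsBelow p v (p x) := by
  obtain ⟨k, hk⟩ := h
  cases k with
  | zero => exact absurd hk hx
  | succ k => exact ⟨k, hk⟩

theorem IsBelow.comparable (h : IsBelow p u x) (h' : IsBelow p w x) :
    IsBelow p u w ∨ IsBelow p w u := by
  obtain ⟨i, rfl⟩ := h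
  obtain ⟨j, rfl⟩ := h'
  rcases le_total i j with hij | hij
  · right
    exact ⟨j - i, by rw [← Function.iterate_add_apply, Nat.sub_add_cancel hij]⟩
  · left
    exact ⟨i - j, by rw [← Function.iterate_add_apply, Nat.sub_add_cancel hij]⟩

/-- Induction from the root of a fringe subtree to its leaves. -/
theorem IsBelow.induction {P : V → Prop} (h : IsBelow p v x) (base : P v)
    (step : ∀ y, y ≠ v → IsBelow p v y → P (p y) → P y) : P x := by
  obtain ⟨k, hk⟩ := h
  induction k generalizing x with
  | zero => rw [← hk] at base; exact base
  | succ k ih =>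
    by_cases hx : x = v
    · rw [hx]; exact base
    · exact step x hx ⟨k + 1, hk⟩ (ih hk)

theorem iterate_eq_of_forall_isBelow (h : ∀ y, IsBelow p y x → q y = p y) (k : ℕ) :
    q^[k] x = p^[k] x := by
  induction k with
  | zero => rfl
  | succ k ih => rw [Function.iterate_succ_apply', Function.iterate_succ_apply', ih,
      h _ ⟨k, rfl⟩]

namespace IsParentFun

/-- The orbit of a point of `W` ends in the fixed point `r`, so a periodic orbit is already
constant: there are no cycles other than fixed points. -/
theorem parent_eq_self_of_iterate (hp : IsParentFun W r p) {k : ℕ} (h : p^[k + 1] x = x) :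
    p x = x := by
  by_cases hx : x ∈ W
  · obtain ⟨j, hj⟩ := hp.reach x hx
    have h1 : p^[(k + 1) * j] x = x := by
      rw [Function.iterate_mul]
      exact Function.iterate_fixed h j
    have h2 : p^[(k + 1) * j] x = r := by
      have : (k + 1) * j = k * j + j := by ring
      rw [this, Function.iterate_add_apply, hj]
      exact Function.iterate_fixed hp.root _
    rw [h1] at h2
    rw [h2, hp.root]
  · exact hp.off x hx

theorem parent_ne (hp : IsParentFun W r p) (hv : v ∈ W) (hvr : v ≠ r) : p v ≠ v := by
  intro h
  obtain ⟨k, hk⟩ := hp.reach v hv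
  rw [Function.iterate_fixed h] at hk
  exact hvr hk

theorem isBelow_antisymm (hp : IsParentFun W r p) (h : IsBelow p u v) (h' : IsBelow p v u) :
    u = v := by
  obtain ⟨i, hi⟩ := h
  obtain ⟨j, hj⟩ := h'
  rcases i with _ | i
  · exact hi.symm
  · have h1 : p^[(j + i) + 1] v = v := by
      rw [add_assoc, Function.iterate_add_apply, hi, hj]
    have h2 := hp.parent_eq_self_of_iterate h1
    rw [← hi, Function.iterate_fixed h2]

theorem not_isBelow_parent (hp : IsParentFun W r p) (hv : p v ≠ v) : ¬ IsBelow p v (p v) :=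
  fun h => hv (hp.isBelow_antisymm h (isBelow_parent p v)).symm

theorem parent_parent_ne (hp : IsParentFun W r p) (hv : p v ≠ v) : p (p v) ≠ v :=
  fun h => hp.not_isBelow_parent hv ⟨1, h⟩

theorem parent_mem (hp : IsParentFun W r p) (hv : v ∈ W) : p v ∈ W := by
  by_contra h
  obtain ⟨k, hk⟩ := hp.reach v hv
  rcases k with _ | k
  · apply h
    rw [show v = r from hk, hp.root]
    exact hp.root_mem
  · rw [Function.iterate_succ_apply, Function.iterate_fixed (hp.off _ h)] at hk
    exact h (hk ▸ hp.root_mem)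

theorem isBelow_root (hp : IsParentFun W r p) (hx : x ∈ W) : IsBelow p r x := hp.reach x hx

theorem isBelow_iff_eq_of_root (hp : IsParentFun W r p) : IsBelow p v r ↔ v = r := by
  constructor
  · rintro ⟨k, hk⟩
    rw [← hk, Function.iterate_fixed hp.root]
  · rintro rfl
    exact .refl _ _

theorem not_isBelow_of_sibling (hp : IsParentFun W r p) (hu : p u ≠ u) (huw : u ≠ w)
    (h : p u = p w) : ¬ IsBelow p u w := by
  intro hb
  have h1 := hb.parent_of_ne huw.symm
  rw [← h] at h1
  exact hp.not_isBelow_parent hu h1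

theorem disjoint_of_siblings (hp : IsParentFun W r p) (hu : p u ≠ u) (hw : p w ≠ w) (huw : u ≠ w)
    (h : p u = p w) : ¬ (IsBelow p u x ∧ IsBelow p w x) := by
  rintro ⟨h1, h2⟩
  rcases h1.comparable h2 with h3 | h3
  · exact hp.not_isBelow_of_sibling hu huw h h3
  · exact hp.not_isBelow_of_sibling hw huw.symm h.symm h3

end IsParentFun

theorem notMem_iterate (hS : ∀ x, p x ∈ S → x ∈ S) (hx : x ∉ S) (k : ℕ) : p^[k] x ∉ S := by
  induction k with
  | zero => exact hx
  | succ k ih => rw [Function.iterate_succ_apply']; exact fun h => ih (hS _ h)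

section Fringe

variable [Fintype V]

open Classical in
/-- The vertex set of the fringe subtree at `v`. -/
noncomputable def fringe (p : V → V) (v : V) : Finset V := Finset.univ.filter (IsBelow p v)

theorem mem_fringe : x ∈ fringe p v ↔ IsBelow p v x := by
  classical simp [fringe]

theorem fringe_subset (h : IsBelow p u v) : fringe p v ⊆ fringe p u := fun _ hx =>
  mem_fringe.2 (h.trans (mem_fringe.1 hx))

/-- The ancestors of `x` form a chain along which the fringe subtrees grow strictly, so size
identifies an ancestor. This is how `u` is recovered in the count of twins. -/
theorem IsParentFun.eq_of_card_fringe_eq (hp : IsParentFun W r p) (hu : IsBelow p u x)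
    (hw : IsBelow p w x) (h : (fringe p u).card = (fringe p w).card) : u = w := by
  wlog huw : IsBelow p u w generalizing u w
  · exact (this hw hu h.symm ((hu.comparable hw).resolve_left huw)).symm
  have h1 := Finset.eq_of_subset_of_card_le (fringe_subset huw) h.le
  have h2 : u ∈ fringe p w := h1 ▸ mem_fringe.2 (.refl p u)
  exact hp.isBelow_antisymm huw (mem_fringe.1 h2)

end Fringe

variable [DecidableEq V]

/-- The parent function `p` with the vertices in `S` deleted. -/
def detach (S : Finset V) (p : V → V) (x : V) : V := if x ∈ S then x else p x

theorem detach_of_mem (h : x ∈ S) : detach S p x = x := if_pos h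

theorem detach_of_notMem (h : x ∉ S) : detach S p x = p x := if_neg h

theorem iterate_detach (hS : ∀ x, p x ∈ S → x ∈ S) (hx : x ∉ S) (k : ℕ) :
    (detach S p)^[k] x = p^[k] x := by
  apply iterate_eq_of_forall_isBelow
  rintro _ ⟨j, rfl⟩
  exact detach_of_notMem (notMem_iterate hS hx j)

theorem isBelow_detach (hS : ∀ x, p x ∈ S → x ∈ S) (hv : v ∉ S) :
    IsBelow (detach S p) v x ↔ x ∉ S ∧ IsBelow p v x := by
  by_cases hx : x ∈ S
  · simp only [hx, not_true_eq_false, false_and, iff_false]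
    rintro ⟨k, hk⟩
    rw [Function.iterate_fixed (detach_of_mem hx)] at hk
    exact hv (hk ▸ hx)
  · simp only [IsBelow, iterate_detach hS hx, hx, not_false_eq_true, true_and]

theorem IsParentFun.detach (hp : IsParentFun W r p) (hr : r ∉ S) (hS : ∀ x, p x ∈ S → x ∈ S) :
    IsParentFun (W \ S) r (detach S p) where
  root_mem := Finset.mem_sdiff.2 ⟨hp.root_mem, hr⟩
  root := by rw [detach_of_notMem hr, hp.root]
  off v hv := by
    by_cases hvS : v ∈ S
    · exact detach_of_mem hvS
    · rw [detach_of_notMem hvS, hp.off]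
      exact fun h => hv (Finset.mem_sdiff.2 ⟨h, hvS⟩)
  reach v hv := by
    rw [Finset.mem_sdiff] at hv
    simp only [iterate_detach hS hv.2]
    exact hp.reach v hv.1

/-- Converse of `IsParentFun.detach`, used to build trees: it is enough that every reattached vertex
climbs into the remaining tree. -/
theorem IsParentFun.of_detach (hq : IsParentFun (W \ S) r q) (hSW : S ⊆ W)
    (heq : ∀ x ∉ S, p x = q x) (hS : ∀ x ∈ S, ∃ k, p^[k] x ∈ W \ S) : IsParentFun W r p := by
  have hit : ∀ x ∈ W \ S, ∀ k, p^[k] x = q^[k] x := by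
    intro x hx k
    have key : p^[k] x = q^[k] x ∧ q^[k] x ∈ W \ S := by
      induction k with
      | zero => exact ⟨rfl, hx⟩
      | succ k ih =>
        rw [Function.iterate_succ_apply', Function.iterate_succ_apply', ih.1,
          heq _ (Finset.mem_sdiff.1 ih.2).2]
        exact ⟨rfl, hq.parent_mem ih.2⟩
    exact key.1
  have hreach : ∀ v ∈ W \ S, ∃ k, p^[k] v = r := by
    intro v hv
    simp only [hit v hv]
    exact hq.reach v hv
  have hr := Finset.mem_sdiff.1 hq.root_mem
  refine ⟨hr.1, by rw [heq r hr.2, hq.root], fun v hv => ?_, fun v hv => ?_⟩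
  · rw [heq v fun h => hv (hSW h)]
    exact hq.off v fun h => hv (Finset.mem_sdiff.1 h).1
  · by_cases hvS : v ∈ S
    · obtain ⟨k, hk⟩ := hS v hvS
      obtain ⟨j, hj⟩ := hreach _ hk
      exact ⟨j + k, by rw [Function.iterate_add_apply, hj]⟩
    · exact hreach v (Finset.mem_sdiff.2 ⟨hv, hvS⟩)

variable [Fintype V]

open Classical in
/-- The set of parent functions of trees with vertex set `W` and root `r`. -/
noncomputable def parentFuns (W : Finset V) (r : V) : Finset (V → V) :=
  Finset.univ.filter (IsParentFun W r)

theorem mem_parentFuns : p ∈ parentFuns W r ↔ IsParentFun W r p := by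
  classical simp [parentFuns]

end ParentFunctions

/-! ### Cayley's formula by inclusion–exclusion on leaves. -/

section Cayley

variable {V : Type} [DecidableEq V] [Fintype V] {W S : Finset V} {r u v w x y : V} {p q : V → V}

open Classical in
/-- Parent functions in which every element of `S` is a leaf. -/
theorem card_parentFuns_filter_leaves (hSW : S ⊆ W.erase r) :
    ((parentFuns W r).filter (fun p => ∀ x, p x ∉ S)).card =
      (W.card - S.card) ^ S.card * (parentFuns (W \ S) r).card := by
  have hS : S ⊆ W := hSW.trans (Finset.erase_subset _ _)
  have hr : r ∉ S := fun h => Finset.notMem_erase r W (hSW h)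
  have h1 : (S.pi fun _ => W \ S).card = (W.card - S.card) ^ S.card := by
    rw [Finset.card_pi, Finset.prod_const, Finset.card_sdiff_of_subset hS]
  rw [← h1, ← Finset.card_product]
  refine Finset.card_nbij'
    (fun p => (fun x _ => p x, detach S p))
    (fun z x => if h : x ∈ S then z.1 x h else z.2 x) ?_ ?_ ?_ ?_
  · intro p hp
    rw [Finset.mem_coe, Finset.mem_filter, mem_parentFuns] at hp
    rw [Finset.mem_coe, Finset.mem_product, mem_parentFuns, Finset.mem_pi]
    exact ⟨fun x hx => Finset.mem_sdiff.2 ⟨hp.1.parent_mem (hS hx), hp.2 x⟩,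
      hp.1.detach hr fun x h => absurd h (hp.2 x)⟩
  · rintro ⟨g, q⟩ hz
    rw [Finset.mem_coe, Finset.mem_product, mem_parentFuns, Finset.mem_pi] at hz
    rw [Finset.mem_coe, Finset.mem_filter, mem_parentFuns]
    obtain ⟨hg, hq⟩ := hz
    dsimp only at hg hq
    refine ⟨hq.of_detach hS (fun x hx => dif_neg hx) fun x hx => ⟨1, ?_⟩, fun x hx => ?_⟩
    · simp only [Function.iterate_one, dif_pos hx]
      exact hg x hx
    · by_cases h : x ∈ S
      · simp only [dif_pos h] at hx
        exact (Finset.mem_sdiff.1 (hg x h)).2 hx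
      · simp only [dif_neg h] at hx
        by_cases hxW : x ∈ W
        · exact (Finset.mem_sdiff.1 (hq.parent_mem (Finset.mem_sdiff.2 ⟨hxW, h⟩))).2 hx
        · rw [hq.off x fun h' => hxW (Finset.mem_sdiff.1 h').1] at hx
          exact h hx
  · intro p _
    funext x
    by_cases h : x ∈ S
    · simp only [dif_pos h]
    · simp only [dif_neg h, detach_of_notMem h]
  · rintro ⟨g, q⟩ hz
    rw [Finset.mem_coe, Finset.mem_product, mem_parentFuns, Finset.mem_pi] at hz
    refine Prod.ext ?_ ?_
    · funext x hx
      simp only [dif_pos hx]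
    · funext x
      change detach S (fun x => if h : x ∈ S then g x h else q x) x = q x
      by_cases h : x ∈ S
      · exact (detach_of_mem h).trans (hz.2.off x fun h' => (Finset.mem_sdiff.1 h').2 h).symm
      · exact (detach_of_notMem h).trans (dif_neg h)

-- Otherwise `p` would be surjective, hence injective on a finite type, yet some iterate sends a
-- non-root vertex to the fixed root.
open Classical in
theorem IsParentFun.exists_leaf (hp : IsParentFun W r p) (hW : 1 < W.card) :
    ∃ v ∈ W.erase r, ∀ x, p x ≠ v := by
  by_contra! hcon
  have hsurj : Function.Surjective p := by
    intro v
    by_cases hv : v ∈ W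
    · by_cases hvr : v = r
      · exact ⟨r, by rw [hp.root, hvr]⟩
      · exact hcon v (Finset.mem_erase.2 ⟨hvr, hv⟩)
    · exact ⟨v, hp.off v hv⟩
  have hinj := Finite.injective_iff_surjective.2 hsurj
  obtain ⟨v, hv, hvr⟩ := Finset.exists_mem_ne hW r
  obtain ⟨k, hk⟩ := hp.reach v hv
  exact hvr (hinj.iterate k (by rw [hk, Function.iterate_fixed hp.root]))

/-- With |s| = m + 1 this is the (m + 1)-st finite difference of x ^ m at 1, summed in reverse
order. -/
theorem sum_powerset_neg_one_pow_mul_pow {α : Type} (s : Finset α) (hs : s.Nonempty) :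
    ∑ t ∈ s.powerset, (-1 : ℤ) ^ t.card * ((s.card + 1 - t.card : ℕ) : ℤ) ^ (s.card - 1) = 0 := by
  obtain ⟨m, hm⟩ : ∃ m, s.card = m + 1 := Nat.exists_eq_add_one.2 hs.card_pos
  rw [Finset.sum_powerset_apply_card
    (fun k => (-1 : ℤ) ^ k * ((s.card + 1 - k : ℕ) : ℤ) ^ (s.card - 1)), hm]
  have h := congrFun (fwdDiff_iter_pow_eq_zero_of_lt (R := ℤ) (Nat.lt_succ_self m)) 1
  rw [fwdDiff_iter_eq_sum_shift, ← Finset.sum_range_reflect] at h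
  refine Eq.trans (Finset.sum_congr rfl fun k hk => ?_) h
  rw [Finset.mem_range] at hk
  have e1 : m.succ + 1 - 1 - k = m + 1 - k := by omega
  have e2 : m.succ - (m + 1 - k) = k := by omega
  have e3 : ((m + 1 + 1 - k : ℕ) : ℤ) = 1 + ((m + 1 - k : ℕ) : ℤ) := by omega
  rw [e1, e2, e3, Nat.choose_symm (by omega : k ≤ m + 1)]
  simp only [nsmul_eq_mul, smul_eq_mul, Nat.add_sub_cancel, mul_one]
  ring

open Classical in
/-- Cayley's formula, for trees with root `r`. -/
theorem card_parentFuns (hr : r ∈ W) : (parentFuns W r).card = W.card ^ (W.card - 2) := by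
  induction hn : W.card using Nat.strong_induction_on generalizing W with
  | _ n ih =>
  subst hn
  have hpos : 0 < W.card := Finset.card_pos.2 ⟨r, hr⟩
  rcases Nat.eq_or_lt_of_le (show 1 ≤ W.card from hpos) with h1 | h1
  · obtain ⟨a, ha⟩ := Finset.card_eq_one.1 h1.symm
    have har : a = r := by rw [ha] at hr; exact (Finset.mem_singleton.1 hr).symm
    subst har
    have : parentFuns W a = {id} := by
      ext p
      rw [mem_parentFuns, Finset.mem_singleton, ha]
      constructor
      · intro hp
        funext x
        by_cases hx : x = a
        · rw [hx, hp.root]; rfl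
        · exact hp.off x fun h => hx (Finset.mem_singleton.1 h)
      · rintro rfl
        exact ⟨Finset.mem_singleton_self a, rfl, fun _ _ => rfl,
          fun v hv => ⟨0, Finset.mem_singleton.1 hv⟩⟩
    rw [this, ← h1]
    rfl
  · set E := W.erase r with hE
    have hEc : E.card + 1 = W.card := Finset.card_erase_add_one hr
    have hEne : E.Nonempty := Finset.card_pos.1 (by omega)
    set L : (V → V) → Finset V := fun p => E.filter fun v => ∀ x, p x ≠ v with hL
    -- Every tree has a nonempty set `L p` of non-root leaves, so its alternating sum over subsets
    -- vanishes. Exchanging the sums gives a recursion for the number of trees.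
    have hzero : ∑ p ∈ parentFuns W r, ∑ S ∈ E.powerset with S ⊆ L p, (-1 : ℤ) ^ S.card = 0 := by
      refine Finset.sum_eq_zero fun p hp => ?_
      have hne : (L p).Nonempty := by
        obtain ⟨v, hv, hv'⟩ := (mem_parentFuns.1 hp).exists_leaf h1
        exact ⟨v, Finset.mem_filter.2 ⟨hv, hv'⟩⟩
      rw [← Finset.sum_powerset_neg_one_pow_card_of_nonempty hne]
      refine Finset.sum_congr ?_ fun _ _ => rfl
      ext S
      rw [Finset.mem_filter, Finset.mem_powerset, Finset.mem_powerset, and_iff_right_iff_imp]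
      exact fun h => h.trans (Finset.filter_subset _ _)
    have hswap : ∑ S ∈ E.powerset, (-1 : ℤ) ^ S.card *
        (((W.card - S.card) ^ S.card * (parentFuns (W \ S) r).card : ℕ) : ℤ) = 0 := by
      rw [← hzero]
      simp only [Finset.sum_filter]
      rw [Finset.sum_comm]
      refine Finset.sum_congr rfl fun S hS => ?_
      rw [Finset.mem_powerset] at hS
      rw [← card_parentFuns_filter_leaves hS, ← Finset.sum_filter, Finset.sum_const, nsmul_eq_mul,
        mul_comm]
      congr 3
      refine Finset.filter_congr fun p _ => ?_
      simp only [hL, Finset.subset_iff, Finset.mem_filter]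
      constructor
      · exact fun h v hv => ⟨hS hv, fun x hx => h x (hx ▸ hv)⟩
      · exact fun h x hx => (h hx).2 x rfl
    have hpoly := sum_powerset_neg_one_pow_mul_pow E hEne
    rw [hEc] at hpoly
    have hmem : (∅ : Finset V) ∈ E.powerset := Finset.empty_mem_powerset E
    rw [← Finset.add_sum_erase _ _ hmem] at hpoly hswap
    -- By induction the exponents |S| and |W| - |S| - 2 add up to |W| - 2 whatever `S` is. The
    -- recursion and the finite-difference identity thus agree in all terms with `S` nonempty, hence
    -- also for `S` empty.
    have hrest : ∀ S ∈ E.powerset.erase ∅, (-1 : ℤ) ^ S.card *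
        (((W.card - S.card) ^ S.card * (parentFuns (W \ S) r).card : ℕ) : ℤ) =
        (-1 : ℤ) ^ S.card * ((W.card - S.card : ℕ) : ℤ) ^ (E.card - 1) := by
      intro S hS
      rw [Finset.mem_erase, Finset.mem_powerset] at hS
      obtain ⟨hS0, hSE⟩ := hS
      have hSW : S ⊆ W := hSE.trans (Finset.erase_subset _ _)
      have hSpos := Finset.card_pos.2 (Finset.nonempty_iff_ne_empty.2 hS0)
      have hSle := Finset.card_le_card hSE
      have hc : (W \ S).card = W.card - S.card := Finset.card_sdiff_of_subset hSW
      have hrS : r ∉ S := fun h => Finset.notMem_erase r W (hSE h)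
      rw [ih (W \ S).card (by omega) (Finset.mem_sdiff.2 ⟨hr, hrS⟩) rfl, hc, ← pow_add]
      -- For `S = E` the subtraction in the exponent is truncated, which is harmless because the
      -- base is 1.
      rcases Nat.eq_or_lt_of_le hSle with h2 | h2
      · have : W.card - S.card = 1 := by omega
        rw [this]
        simp
      · have : S.card + (W.card - S.card - 2) = E.card - 1 := by omega
        rw [this]
        push_cast
        rfl
    rw [Finset.sum_congr rfl hrest] at hswap
    have := hswap.trans hpoly.symm
    rw [add_left_inj] at this
    simp only [Finset.card_empty, pow_zero, one_mul, Nat.sub_zero, Finset.sdiff_empty] at this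
    have e : W.card - 2 = E.card - 1 := by omega
    rw [e]
    exact_mod_cast this

end Cayley

/-! ### Pendant paths, pendant cherries and the switch between them. -/

section Slots

variable {V : Type} {W S : Finset V} {r u v w x y a b : V} {p q : V → V}

/-- The fringe subtree at `v` is the path `v - a - b`. -/
structure IsPathSlot (p : V → V) (v a b : V) : Prop where
  ne_va : v ≠ a
  ne_vb : v ≠ b
  ne_ab : a ≠ b
  parent_a : p a = v
  parent_b : p b = a
  of_parent_eq_v : ∀ x, p x = v → x = a
  of_parent_eq_a : ∀ x, p x = a → x = b
  parent_ne_b : ∀ x, p x ≠ b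

/-- The fringe subtree at `v` is a cherry with leaves `a` and `b`. -/
structure IsCherrySlot (p : V → V) (v a b : V) : Prop where
  ne_va : v ≠ a
  ne_vb : v ≠ b
  ne_ab : a ≠ b
  parent_a : p a = v
  parent_b : p b = v
  of_parent_eq_v : ∀ x, p x = v → x = a ∨ x = b
  parent_ne_a : ∀ x, p x ≠ a
  parent_ne_b : ∀ x, p x ≠ b

namespace IsPathSlot

variable [DecidableEq V]

theorem closed (h : IsPathSlot p v a b) (x : V) (hx : p x ∈ ({v, a, b} : Finset V)) :
    x ∈ ({v, a, b} : Finset V) := by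
  simp only [Finset.mem_insert, Finset.mem_singleton] at hx ⊢
  rcases hx with hx | hx | hx
  · exact .inr (.inl (h.of_parent_eq_v x hx))
  · exact .inr (.inr (h.of_parent_eq_a x hx))
  · exact absurd hx (h.parent_ne_b x)

theorem parent_notMem (h : IsPathSlot p v a b) : p v ∉ ({v, a, b} : Finset V) := by
  simp only [Finset.mem_insert, Finset.mem_singleton]
  rintro (hx | hx | hx)
  · exact h.ne_va (h.of_parent_eq_v v hx)
  · exact h.ne_vb (h.of_parent_eq_a v hx)
  · exact h.parent_ne_b v hx

theorem root_notMem (h : IsPathSlot p v a b) (hp : IsParentFun W r p) :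
    r ∉ ({v, a, b} : Finset V) := by
  intro hr
  simp only [Finset.mem_insert, Finset.mem_singleton] at hr
  have h1 := hp.root
  rcases hr with hr | hr | hr
  · have := h.of_parent_eq_v r (by rw [h1, hr])
    exact h.ne_va (hr ▸ this)
  · have := h.of_parent_eq_a r (by rw [h1, hr])
    exact h.ne_ab (hr ▸ this)
  · exact h.parent_ne_b r (by rw [h1, hr])

theorem subset (h : IsPathSlot p v a b) (hp : IsParentFun W r p) : {v, a, b} ⊆ W := by
  intro x hx
  by_contra hxW
  have h1 := hp.off x hxW
  simp only [Finset.mem_insert, Finset.mem_singleton] at hx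
  rcases hx with rfl | rfl | rfl
  · exact h.ne_va (h.of_parent_eq_v x h1)
  · exact h.ne_ab (h.of_parent_eq_a x h1)
  · exact h.parent_ne_b x h1

/-- Moving the leaf of a path to its root gives a cherry. -/
theorem isCherrySlot_update (h : IsPathSlot p v a b) :
    IsCherrySlot (Function.update p b v) v a b := by
  obtain ⟨h1, h2, h3, h4, h5, h6, h7, h8⟩ := h
  constructor <;> grind [Function.update_apply]

theorem isParentFun_update (h : IsPathSlot p v a b) (hp : IsParentFun W r p) :
    IsParentFun W r (Function.update p b v) := by
  refine (hp.detach (h.root_notMem hp) h.closed).of_detach (h.subset hp) ?_ ?_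
  · intro x hx
    rw [detach_of_notMem hx, Function.update_of_ne]
    rintro rfl
    simp at hx
  · have h1 : p v ∈ W \ {v, a, b} :=
      Finset.mem_sdiff.2 ⟨hp.parent_mem (h.subset hp (by simp)), h.parent_notMem⟩
    have hb : Function.update p b v b = v := Function.update_self b v p
    have hv : Function.update p b v v = p v := Function.update_of_ne h.ne_vb _ _
    have ha : Function.update p b v a = v := by rw [Function.update_of_ne h.ne_ab, h.parent_a]
    intro x hx
    simp only [Finset.mem_insert, Finset.mem_singleton] at hx
    rcases hx with rfl | rfl | rfl
    · exact ⟨1, by rw [Function.iterate_one, hv]; exact h1⟩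
    · exact ⟨2, by simp only [Function.iterate_succ, Function.iterate_zero, id,
        Function.comp_apply, ha, hv]; exact h1⟩
    · exact ⟨2, by simp only [Function.iterate_succ, Function.iterate_zero, id,
        Function.comp_apply, hb, hv]; exact h1⟩

end IsPathSlot

namespace IsCherrySlot

variable [DecidableEq V]

/-- Moving a leaf of a cherry to the other leaf gives a path. -/
theorem isPathSlot_update (h : IsCherrySlot p v a b) :
    IsPathSlot (Function.update p b a) v a b := by
  obtain ⟨h1, h2, h3, h4, h5, h6, h7, h8⟩ := h
  constructor <;> grind [Function.update_apply]

theorem isParentFun_update (h : IsCherrySlot p v a b) (hp : IsParentFun W r p) :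
    IsParentFun W r (Function.update p b a) := by
  obtain ⟨h1, h2, h3, h4, h5, h6, h7, h8⟩ := h
  have hroot := hp.root
  have hr : r ∉ ({v, a, b} : Finset V) := by grind
  have hcl : ∀ x, p x ∈ ({v, a, b} : Finset V) → x ∈ ({v, a, b} : Finset V) := by grind
  have hpv : p v ∉ ({v, a, b} : Finset V) := by grind
  have hsub : {v, a, b} ⊆ W := by
    intro x hx
    by_contra hxW
    have := hp.off x hxW
    grind
  refine (hp.detach hr hcl).of_detach hsub ?_ ?_
  · intro x hx
    rw [detach_of_notMem hx, Function.update_of_ne]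
    rintro rfl
    simp at hx
  · have h1 : p v ∈ W \ {v, a, b} :=
      Finset.mem_sdiff.2 ⟨hp.parent_mem (hsub (by simp)), hpv⟩
    have hb : Function.update p b a b = a := Function.update_self b a p
    have hv : Function.update p b a v = p v := Function.update_of_ne h2 _ _
    have ha : Function.update p b a a = v := by rw [Function.update_of_ne h3, h4]
    intro x hx
    simp only [Finset.mem_insert, Finset.mem_singleton] at hx
    rcases hx with rfl | rfl | rfl
    · exact ⟨1, by rw [Function.iterate_one, hv]; exact h1⟩
    · exact ⟨2, by simp only [Function.iterate_succ, Function.iterate_zero, id,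
        Function.comp_apply, ha, hv]; exact h1⟩
    · exact ⟨3, by simp only [Function.iterate_succ, Function.iterate_zero, id,
        Function.comp_apply, hb, ha, hv]; exact h1⟩

end IsCherrySlot

variable [Fintype V]

open Classical in
/-- The triples `(v, a, b)` such that the fringe subtree at `v` is the path `v - a - b`. -/
noncomputable def pathSlots (p : V → V) : Finset (V × V × V) :=
  Finset.univ.filter fun t => IsPathSlot p t.1 t.2.1 t.2.2

theorem mem_pathSlots {t : V × V × V} : t ∈ pathSlots p ↔ IsPathSlot p t.1 t.2.1 t.2.2 := by
  classical simp [pathSlots]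

open Classical in
/-- The triples `(v, a, b)` such that the fringe subtree at `v` is a cherry with leaves `a, b`. -/
noncomputable def cherrySlots (p : V → V) : Finset (V × V × V) :=
  Finset.univ.filter fun t => IsCherrySlot p t.1 t.2.1 t.2.2

theorem mem_cherrySlots {t : V × V × V} :
    t ∈ cherrySlots p ↔ IsCherrySlot p t.1 t.2.1 t.2.2 := by
  classical simp [cherrySlots]

/-- Twice the number of fringe subtrees that are cherries minus the number of those that are
paths with three vertices. -/
noncomputable def slotBalance (p : V → V) : ℝ := (cherrySlots p).card - (pathSlots p).card

variable [DecidableEq V]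

/-- The parent function in which the path `t` is replaced with a cherry. -/
def bendPath (p : V → V) (t : V × V × V) : V → V := Function.update p t.2.2 t.1

/-- The switch affects only the fringe subtrees at `v`, `a`, `b` and at proper ancestors of `v`, and
the latter have more than three vertices. So the new cherry, in its two orders, is the only change.
-/
theorem cherrySlots_bendPath {t : V × V × V} (h : t ∈ pathSlots p) :
    (cherrySlots (bendPath p t)).card = (cherrySlots p).card + 2 := by
  obtain ⟨v, a, b⟩ := t
  rw [mem_pathSlots] at h
  dsimp only at h
  have h1 : cherrySlots (bendPath p (v, a, b)) =
      insert (v, a, b) (insert (v, b, a) (cherrySlots p)) := by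
    obtain ⟨h1, h2, h3, h4, h5, h6, h7, h8⟩ := h
    ext ⟨x, y, z⟩
    simp only [Finset.mem_insert, mem_cherrySlots, Prod.mk.injEq, bendPath]
    constructor
    · rintro ⟨g1, g2, g3, g4, g5, g6, g7, g8⟩
      simp only [Function.update_apply] at g4 g5 g6 g7 g8
      by_cases hy : y = b
      · grind
      · by_cases hz : z = b
        · grind
        · rw [if_neg hy] at g4
          rw [if_neg hz] at g5
          right; right
          have hxa : x ≠ a := by grind
          have hya : y ≠ a := by grind
          have hza : z ≠ a := by grind
          refine ⟨g1, g2, g3, g4, g5, fun w hw => ?_, fun w hw => ?_, fun w hw => ?_⟩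
          · have := g6 w; grind
          · have := g7 w; grind
          · have := g8 w; grind
    · rintro (⟨rfl, rfl, rfl⟩ | ⟨rfl, rfl, rfl⟩ | ⟨g1, g2, g3, g4, g5, g6, g7, g8⟩)
      · constructor <;> grind [Function.update_apply]
      · constructor <;> grind [Function.update_apply]
      · constructor <;> grind [Function.update_apply]
  rw [h1, Finset.card_insert_of_notMem, Finset.card_insert_of_notMem]
  · rw [mem_cherrySlots]
    exact fun h' => h.ne_va (h'.parent_a.symm.trans h.parent_b)
  · rw [Finset.mem_insert, mem_cherrySlots]
    rintro (h' | h')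
    · exact h.ne_ab (Prod.mk.inj (Prod.mk.inj h').2).1
    · exact h.ne_va (h'.parent_b.symm.trans h.parent_b)

theorem pathSlots_bendPath {t : V × V × V} (h : t ∈ pathSlots p) :
    (pathSlots (bendPath p t)).card + 1 = (pathSlots p).card := by
  have ht := h
  obtain ⟨v, a, b⟩ := t
  rw [mem_pathSlots] at h
  dsimp only at h
  have h1 : pathSlots (bendPath p (v, a, b)) = (pathSlots p).erase (v, a, b) := by
    obtain ⟨h1, h2, h3, h4, h5, h6, h7, h8⟩ := h
    ext ⟨x, y, z⟩
    simp only [Finset.mem_erase, mem_pathSlots, ne_eq, Prod.mk.injEq, bendPath]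
    constructor
    · rintro ⟨g1, g2, g3, g4, g5, g6, g7, g8⟩
      simp only [Function.update_apply] at g4 g5 g6 g7 g8
      have e1 := g6 b
      have e2 := g6 a
      have e3 := g7 b
      have e4 := g7 a
      have hy : y ≠ b := by grind
      have hz : z ≠ b := by grind
      have hza : z ≠ a := by grind
      rw [if_neg hy] at g4
      rw [if_neg hz] at g5
      refine ⟨by grind, g1, g2, g3, g4, g5, fun w hw => ?_, fun w hw => ?_, fun w hw => ?_⟩
      · have := g6 w; grind
      · have := g7 w; grind
      · have := g8 w; grind
    · rintro ⟨g0, g1, g2, g3, g4, g5, g6, g7, g8⟩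
      have e1 := g6 b
      have e2 := g6 a
      have e3 := g7 b
      have e4 := g7 a
      constructor <;> grind [Function.update_apply]
  rw [h1, Finset.card_erase_add_one ht]

theorem slotBalance_bendPath {t : V × V × V} (h : t ∈ pathSlots p) :
    slotBalance (bendPath p t) - slotBalance p = 3 := by
  have h1 := cherrySlots_bendPath h
  have h2 := pathSlots_bendPath h
  rw [slotBalance, slotBalance, h1, ← h2]
  push_cast
  ring

/-- Double counting: bending maps pairs (tree, path) bijectively to pairs (tree, ordered cherry),
with inverse moving `b` below `a`. A sum over the cherries of a tree can thus be traded for a sum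
over paths, evaluated at the bent tree. -/
theorem sum_mul_slotBalance (G : (V → V) → ℝ) :
    ∑ p ∈ parentFuns W r, G p * slotBalance p =
      ∑ p ∈ parentFuns W r, ∑ t ∈ pathSlots p, (G (bendPath p t) - G p) := by
  have h : ∑ p ∈ parentFuns W r, ∑ t ∈ pathSlots p, G (bendPath p t) =
      ∑ p ∈ parentFuns W r, ∑ t ∈ cherrySlots p, G p := by
    rw [Finset.sum_sigma', Finset.sum_sigma']
    refine Finset.sum_nbij' (fun z => ⟨bendPath z.1 z.2, z.2⟩)
      (fun z => ⟨Function.update z.1 z.2.2.2 z.2.2.1, z.2⟩) ?_ ?_ ?_ ?_ ?_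
    · rintro ⟨p, t⟩ hz
      rw [Finset.mem_sigma, mem_parentFuns, mem_pathSlots] at hz
      rw [Finset.mem_sigma, mem_parentFuns, mem_cherrySlots]
      exact ⟨hz.2.isParentFun_update hz.1, hz.2.isCherrySlot_update⟩
    · rintro ⟨p, t⟩ hz
      rw [Finset.mem_sigma, mem_parentFuns, mem_cherrySlots] at hz
      rw [Finset.mem_sigma, mem_parentFuns, mem_pathSlots]
      exact ⟨hz.2.isParentFun_update hz.1, hz.2.isPathSlot_update⟩
    · rintro ⟨p, t⟩ hz
      rw [Finset.mem_sigma, mem_parentFuns, mem_pathSlots] at hz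
      simp only [bendPath, Function.update_idem]
      congr 1
      exact Function.update_eq_self_iff.2 hz.2.parent_b.symm
    · rintro ⟨p, t⟩ hz
      rw [Finset.mem_sigma, mem_parentFuns, mem_cherrySlots] at hz
      simp only [bendPath, Function.update_idem]
      congr 1
      exact Function.update_eq_self_iff.2 hz.2.parent_b.symm
    · rintro ⟨p, t⟩ _
      rfl
  simp only [Finset.sum_sub_distrib, h, Finset.sum_const, nsmul_eq_mul, slotBalance]
  rw [← Finset.sum_sub_distrib]
  exact Finset.sum_congr rfl fun p _ => by ring

/-- The total number of path slots in all trees with `m` vertices and a given root. -/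
def pathTotal (m : ℕ) : ℕ := (m - 1) * (m - 2) * (m - 3) * (m - 3) ^ (m - 4)

-- Such a tree amounts to the vertex at which the path is attached and a tree on the remaining
-- vertices.
open Classical in
theorem card_filter_isPathSlot (hva : v ≠ a) (hvb : v ≠ b) (hab : a ≠ b)
    (hsub : {v, a, b} ⊆ W.erase r) :
    ((parentFuns W r).filter fun p => IsPathSlot p v a b).card =
      (W \ {v, a, b}).card * (parentFuns (W \ {v, a, b}) r).card := by
  rw [← Finset.card_product]
  have hW : {v, a, b} ⊆ W := hsub.trans (Finset.erase_subset _ _)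
  refine Finset.card_nbij' (fun p => (p v, detach {v, a, b} p))
    (fun z x => if x = v then z.1 else if x = a then v else if x = b then a else z.2 x)
    ?_ ?_ ?_ ?_
  · intro p hp
    rw [Finset.mem_coe, Finset.mem_filter, mem_parentFuns] at hp
    rw [Finset.mem_coe, Finset.mem_product, mem_parentFuns, Finset.mem_sdiff]
    exact ⟨⟨hp.1.parent_mem (hW (by simp)), hp.2.parent_notMem⟩,
      hp.1.detach (hp.2.root_notMem hp.1) hp.2.closed⟩
  · rintro ⟨w, q⟩ hz
    rw [Finset.mem_coe, Finset.mem_product, mem_parentFuns] at hz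
    rw [Finset.mem_coe, Finset.mem_filter, mem_parentFuns]
    obtain ⟨hw, hq⟩ := hz
    dsimp only at hw hq ⊢
    have hw' := (Finset.mem_sdiff.1 hw).2
    simp only [Finset.mem_insert, Finset.mem_singleton, not_or] at hw'
    have hq' : ∀ x, x ≠ v → x ≠ a → x ≠ b → q x ≠ v ∧ q x ≠ a ∧ q x ≠ b := by
      intro x h1 h2 h3
      by_cases hx : x ∈ W
      · have := hq.parent_mem (v := x) (Finset.mem_sdiff.2 ⟨hx, by simp [h1, h2, h3]⟩)
        simpa using (Finset.mem_sdiff.1 this).2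
      · rw [hq.off x fun h => hx (Finset.mem_sdiff.1 h).1]
        exact ⟨h1, h2, h3⟩
    refine ⟨hq.of_detach hW ?_ ?_, ?_⟩
    · intro x hx
      simp only [Finset.mem_insert, Finset.mem_singleton, not_or] at hx
      simp only [if_neg hx.1, if_neg hx.2.1, if_neg hx.2.2]
    · intro x hx
      simp only [Finset.mem_insert, Finset.mem_singleton] at hx
      rcases hx with rfl | rfl | rfl
      · refine ⟨1, ?_⟩
        simpa using hw
      · refine ⟨2, ?_⟩
        simpa [hva.symm] using hw
      · refine ⟨3, ?_⟩
        simpa [hvb.symm, hab.symm, hva.symm] using hw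
    · constructor <;> grind
  · intro p hp
    rw [Finset.mem_coe, Finset.mem_filter, mem_parentFuns] at hp
    funext x
    dsimp only
    split_ifs with h1 h2 h3
    · rw [h1]
    · rw [h2, hp.2.parent_a]
    · rw [h3, hp.2.parent_b]
    · exact detach_of_notMem (by simp [h1, h2, h3])
  · rintro ⟨w, q⟩ hz
    rw [Finset.mem_coe, Finset.mem_product, mem_parentFuns] at hz
    refine Prod.ext (if_pos rfl) ?_
    funext x
    change detach {v, a, b}
      (fun x => if x = v then w else if x = a then v else if x = b then a else q x) x = q x
    by_cases hx : x ∈ ({v, a, b} : Finset V)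
    · exact (detach_of_mem hx).trans (hz.2.off x fun h => (Finset.mem_sdiff.1 h).2 hx).symm
    · rw [detach_of_notMem hx]
      simp only [Finset.mem_insert, Finset.mem_singleton, not_or] at hx
      simp only [if_neg hx.1, if_neg hx.2.1, if_neg hx.2.2]

-- With m = |W|, there are (m - 1)(m - 2)(m - 3) ordered triples avoiding the root, each with m - 3
-- points of attachment and, by Cayley, (m - 3) ^ (m - 5) trees on the rest.
open Classical in
theorem sum_card_pathSlots (hr : r ∈ W) :
    ∑ p ∈ parentFuns W r, (pathSlots p).card = pathTotal W.card := by
  have h0 : ∀ v a b : V, ((parentFuns W r).filter fun p => IsPathSlot p v a b).card =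
      if v ∈ W.erase r then if a ∈ (W.erase r).erase v then
        if b ∈ ((W.erase r).erase v).erase a then (W.card - 3) ^ (W.card - 4) else 0
        else 0 else 0 := by
    intro v a b
    by_cases h : v ∈ W.erase r ∧ a ∈ (W.erase r).erase v ∧ b ∈ ((W.erase r).erase v).erase a
    · rw [if_pos h.1, if_pos h.2.1, if_pos h.2.2]
      obtain ⟨hv, ha, hb⟩ := h
      simp only [Finset.mem_erase] at hv ha hb
      have hsub : {v, a, b} ⊆ W.erase r := by
        intro x hx
        simp only [Finset.mem_insert, Finset.mem_singleton] at hx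
        rw [Finset.mem_erase]
        rcases hx with rfl | rfl | rfl
        · exact hv
        · exact ha.2
        · exact hb.2.2
      rw [card_filter_isPathSlot ha.1.symm hb.2.1.symm hb.1.symm hsub]
      have h3 : ({v, a, b} : Finset V).card = 3 :=
        Finset.card_eq_three.2 ⟨v, a, b, ha.1.symm, hb.2.1.symm, hb.1.symm, rfl⟩
      have hc := Finset.card_sdiff_of_subset (hsub.trans (Finset.erase_subset r W))
      have hrm : r ∈ W \ {v, a, b} :=
        Finset.mem_sdiff.2 ⟨hr, fun h => Finset.notMem_erase r W (hsub h)⟩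
      have hpos := Finset.card_pos.2 ⟨r, hrm⟩
      rw [card_parentFuns hrm, hc, h3]
      rw [hc, h3] at hpos
      obtain ⟨m, hm⟩ : ∃ m, W.card = m + 4 := ⟨W.card - 4, by omega⟩
      rw [hm, show m + 4 - 3 = m + 1 by omega, show m + 1 - 2 = m - 1 by omega,
        show m + 4 - 4 = m by omega]
      -- When `W` has four vertices the Cayley exponent is truncated; the base is then 1.
      rcases m with _ | m
      · rfl
      · rw [Nat.add_sub_cancel, pow_succ, mul_comm]
    · have hne : ¬ ∃ p ∈ parentFuns W r, IsPathSlot p v a b := by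
        rintro ⟨p, hp, hs⟩
        rw [mem_parentFuns] at hp
        have h1 := hs.subset hp
        have h2 := hs.root_notMem hp
        have h3 := hs.ne_va
        have h4 := hs.ne_vb
        have h5 := hs.ne_ab
        apply h
        simp only [Finset.insert_subset_iff, Finset.singleton_subset_iff] at h1
        simp only [Finset.mem_insert, Finset.mem_singleton, not_or] at h2
        simp only [Finset.mem_erase]
        exact ⟨⟨Ne.symm h2.1, h1.1⟩, ⟨h3.symm, Ne.symm h2.2.1, h1.2.1⟩,
          h5.symm, h4.symm, Ne.symm h2.2.2, h1.2.2⟩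
      rw [Finset.card_eq_zero.2 (Finset.filter_eq_empty_iff.2 fun p hp hs => hne ⟨p, hp, hs⟩)]
      split_ifs with h1 h2 h3
      · exact absurd ⟨h1, h2, h3⟩ h
      all_goals rfl
  have h1 : ∑ p ∈ parentFuns W r, (pathSlots p).card =
      ∑ v, ∑ a, ∑ b, ((parentFuns W r).filter fun p => IsPathSlot p v a b).card := by
    simp only [pathSlots, Finset.card_filter]
    rw [Finset.sum_comm, Fintype.sum_prod_type]
    refine Finset.sum_congr rfl fun v _ => ?_
    rw [Fintype.sum_prod_type]
  have hE : (W.erase r).card = W.card - 1 := Finset.card_erase_of_mem hr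
  rw [h1]
  simp only [h0]
  have h2 : ∀ v ∈ W.erase r, ∀ a ∈ (W.erase r).erase v,
      (∑ b, if b ∈ ((W.erase r).erase v).erase a then (W.card - 3) ^ (W.card - 4) else 0) =
      (W.card - 3) * (W.card - 3) ^ (W.card - 4) := by
    intro v hv a ha
    rw [Finset.sum_ite_mem, Finset.univ_inter, Finset.sum_const, smul_eq_mul,
      Finset.card_erase_of_mem ha, Finset.card_erase_of_mem hv, hE]
    rfl
  have h3 : ∀ v ∈ W.erase r, (∑ a, if a ∈ (W.erase r).erase v then
      (∑ b, if b ∈ ((W.erase r).erase v).erase a then (W.card - 3) ^ (W.card - 4) else 0) else 0) =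
      (W.card - 2) * ((W.card - 3) * (W.card - 3) ^ (W.card - 4)) := by
    intro v hv
    rw [Finset.sum_ite_mem, Finset.univ_inter, Finset.sum_congr rfl (h2 v hv), Finset.sum_const,
      smul_eq_mul, Finset.card_erase_of_mem hv, hE]
    rfl
  have h4 : ∀ v, (∑ a, ∑ b, if v ∈ W.erase r then if a ∈ (W.erase r).erase v then
        if b ∈ ((W.erase r).erase v).erase a then (W.card - 3) ^ (W.card - 4) else 0
        else 0 else 0) = if v ∈ W.erase r then
      (W.card - 2) * ((W.card - 3) * (W.card - 3) ^ (W.card - 4)) else 0 := by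
    intro v
    by_cases hv : v ∈ W.erase r
    · simp only [if_pos hv]
      rw [← h3 v hv]
      refine Finset.sum_congr rfl fun a _ => ?_
      by_cases ha : a ∈ (W.erase r).erase v
      · simp only [if_pos ha]
      · simp only [if_neg ha, Finset.sum_const_zero]
    · simp only [if_neg hv, Finset.sum_const_zero]
  simp only [h4]
  rw [Finset.sum_ite_mem, Finset.univ_inter, Finset.sum_const, smul_eq_mul, hE, pathTotal]
  ring

end Slots

/-! ### Twins of vertices above a path, and why they are rare. -/

section Twins

variable {V : Type} {W S : Finset V} {r u v w x y a b : V} {p q f : V → V}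

/-- `f` is an isomorphism from the fringe subtree at `u`, for the parent function `p`, to the fringe
subtree at `w`, for the parent function `q`. -/
structure IsFringeIso (p q : V → V) (u w : V) (f : V → V) : Prop where
  map_root : f u = w
  map_parent : ∀ x, IsBelow p u x → x ≠ u → f (p x) = q (f x)
  inj : ∀ x y, IsBelow p u x → IsBelow p u y → f x = f y → x = y
  surj : ∀ y, IsBelow q w y → ∃ x, IsBelow p u x ∧ f x = y

theorem IsFringeIso.isBelow (hf : IsFringeIso p q u w f) (hx : IsBelow p u x) :
    IsBelow q w (f x) := by
  refine hx.induction (P := fun x => IsBelow q w (f x)) ?_ ?_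
  · rw [hf.map_root]; exact .refl _ _
  · intro y hy hby h
    rw [hf.map_parent y hby hy] at h
    exact h.trans (isBelow_parent q (f y))

theorem IsPathSlot.detach [DecidableEq V] (h : IsPathSlot p v a b) (hv : v ∉ S) (ha : a ∉ S) (hb : b ∉ S) :
    IsPathSlot (detach S p) v a b where
  ne_va := h.ne_va
  ne_vb := h.ne_vb
  ne_ab := h.ne_ab
  parent_a := by rw [detach_of_notMem ha, h.parent_a]
  parent_b := by rw [detach_of_notMem hb, h.parent_b]
  of_parent_eq_v x hx := by
    by_cases hxS : x ∈ S
    · rw [detach_of_mem hxS] at hx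
      exact absurd (hx ▸ hxS) hv
    · rw [detach_of_notMem hxS] at hx
      exact h.of_parent_eq_v x hx
  of_parent_eq_a x hx := by
    by_cases hxS : x ∈ S
    · rw [detach_of_mem hxS] at hx
      exact absurd (hx ▸ hxS) ha
    · rw [detach_of_notMem hxS] at hx
      exact h.of_parent_eq_a x hx
  parent_ne_b x hx := by
    by_cases hxS : x ∈ S
    · rw [detach_of_mem hxS] at hx
      exact absurd (hx ▸ hxS) hb
    · rw [detach_of_notMem hxS] at hx
      exact h.parent_ne_b x hx

/-- The set of values of a list of distinct vertices other than `r`. -/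
def valueSet [DecidableEq V] {k : ℕ} (ψ : Fin k ↪ {x : V // x ≠ r}) : Finset V :=
  Finset.univ.image fun i => (ψ i : V)

theorem card_valueSet [DecidableEq V] {k : ℕ} (ψ : Fin k ↪ {x : V // x ≠ r}) : (valueSet ψ).card = k := by
  rw [valueSet, Finset.card_image_of_injective, Finset.card_univ, Fintype.card_fin]
  exact Subtype.val_injective.comp ψ.injective

variable [Fintype V]

theorem IsPathSlot.three_le_card_fringe (h : IsPathSlot p v a b) (hu : IsBelow p u v) :
    3 ≤ (fringe p u).card := by
  classical
  rw [← Finset.card_eq_three.2 ⟨v, a, b, h.ne_va, h.ne_vb, h.ne_ab, rfl⟩]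
  apply Finset.card_le_card
  have ha : IsBelow p u a := hu.trans ⟨1, h.parent_a⟩
  have hb : IsBelow p u b := ha.trans ⟨1, h.parent_b⟩
  intro x hx
  simp only [Finset.mem_insert, Finset.mem_singleton] at hx
  rw [mem_fringe]
  rcases hx with rfl | rfl | rfl <;> assumption

open Classical in
/-- The siblings of `u` whose fringe subtree is isomorphic to that of `u`. -/
noncomputable def twins (p : V → V) (u : V) : Finset V :=
  Finset.univ.filter fun w => w ≠ u ∧ p w ≠ w ∧ p w = p u ∧ ∃ f, IsFringeIso p p u w f

theorem mem_twins :
    w ∈ twins p u ↔ w ≠ u ∧ p w ≠ w ∧ p w = p u ∧ ∃ f, IsFringeIso p p u w f := by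
  classical simp [twins]

theorem fringe_closed (p : V → V) (w x : V) (hx : p x ∈ fringe p w) : x ∈ fringe p w := by
  rw [mem_fringe] at hx ⊢
  exact hx.trans (isBelow_parent p x)

/-- `ψ` lists the images, under an isomorphism of the fringe subtrees at `u` and `w`, of the
vertices of the former, in a fixed order. -/
def ListsTwin {k : ℕ} (p : V → V) (u w : V) (ψ : Fin k ↪ {x : V // x ≠ r}) : Prop :=
  ∃ f, IsFringeIso p p u w f ∧ ∃ h : (fringe p u).card = k,
    ∀ i, (ψ i : V) = f ((Finset.equivFinOfCardEq h).symm i)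

theorem IsFringeIso.exists_listsTwin (hp : IsParentFun W r p) (hw : p w ≠ w) {k : ℕ}
    (hf : IsFringeIso p p u w f) (hk : (fringe p u).card = k) :
    ∃ ψ : Fin k ↪ {x : V // x ≠ r}, ListsTwin p u w ψ := by
  have hne : ∀ x, IsBelow p u x → f x ≠ r := by
    intro x hx h
    have h1 := hf.isBelow hx
    rw [h, hp.isBelow_iff_eq_of_root] at h1
    exact hw (by rw [h1, hp.root])
  refine ⟨⟨fun i => ⟨f ((Finset.equivFinOfCardEq hk).symm i),
    hne _ (mem_fringe.1 ((Finset.equivFinOfCardEq hk).symm i).2)⟩, fun i j hij => ?_⟩,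
    f, hf, hk, fun i => rfl⟩
  have h1 := hf.inj _ _ (mem_fringe.1 ((Finset.equivFinOfCardEq hk).symm i).2)
    (mem_fringe.1 ((Finset.equivFinOfCardEq hk).symm j).2) (Subtype.mk.inj hij)
  exact (Finset.equivFinOfCardEq hk).symm.injective (Subtype.ext h1)

variable [DecidableEq V]

theorem ListsTwin.valueSet_eq {k : ℕ} {ψ : Fin k ↪ {x : V // x ≠ r}} (h : ListsTwin p u w ψ) :
    valueSet ψ = fringe p w := by
  obtain ⟨f, hf, hk, hψ⟩ := h
  ext y
  simp only [valueSet, Finset.mem_image, Finset.mem_univ, true_and, hψ, mem_fringe]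
  constructor
  · rintro ⟨i, rfl⟩
    exact hf.isBelow (mem_fringe.1 ((Finset.equivFinOfCardEq hk).symm i).2)
  · intro hy
    obtain ⟨x, hx, rfl⟩ := hf.surj y hy
    exact ⟨Finset.equivFinOfCardEq hk ⟨x, mem_fringe.2 hx⟩, by simp⟩

open Classical in
/-- The parent functions with a path slot, a vertex `u` above it with `k` descendants, and a twin
of `u`. -/
noncomputable def twinConfigs (r : V) (k : ℕ) : Finset ((V → V) × (V × V × V) × V × V) :=
  Finset.univ.filter fun z => IsParentFun Finset.univ r z.1 ∧
    IsPathSlot z.1 z.2.1.1 z.2.1.2.1 z.2.1.2.2 ∧ z.1 z.2.2.1 ≠ z.2.2.1 ∧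
    IsBelow z.1 z.2.2.1 z.2.1.1 ∧ (fringe z.1 z.2.2.1).card = k ∧ z.2.2.2 ∈ twins z.1 z.2.2.1

/-- Fringe subtrees at siblings are disjoint, so the one at `u` survives the deletion and its size
can still be read off. -/
theorem fringe_eq_of_twins (hp : IsParentFun W r p) (hu : p u ≠ u) (hw : w ∈ twins p u) :
    fringe (detach (fringe p w) p) u = fringe p u := by
  rw [mem_twins] at hw
  have hcl := fringe_closed p w
  have hdisj : ∀ x, IsBelow p u x → x ∉ fringe p w := by
    intro x hx hx'
    exact hp.disjoint_of_siblings hu hw.2.1 hw.1.symm hw.2.2.1.symm ⟨hx, mem_fringe.1 hx'⟩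
  ext x
  rw [mem_fringe, mem_fringe, isBelow_detach hcl (hdisj u (.refl _ _))]
  exact ⟨fun h => h.2, fun h => ⟨hdisj x h, h⟩⟩

/-- A parent function is determined by what remains after deleting the fringe subtree at a twin,
together with the list of deleted vertices. -/
theorem eq_of_listsTwin_of_detach_eq {k : ℕ} {ψ : Fin k ↪ {x : V // x ≠ r}} {u' w' : V}
    (hp : IsParentFun W r p) (hq : IsParentFun W r q)
    (hu : p u ≠ u) (hu' : q u' ≠ u') (hw : w ∈ twins p u) (hw' : w' ∈ twins q u')
    (hv : IsBelow p u v) (hv' : IsBelow q u' v)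
    (h : ListsTwin p u w ψ) (h' : ListsTwin q u' w' ψ)
    (heq : detach (valueSet ψ) p = detach (valueSet ψ) q) : p = q ∧ u = u' ∧ w = w' := by
  have e1 := fringe_eq_of_twins hp hu hw
  have e2 := fringe_eq_of_twins hq hu' hw'
  rw [← h.valueSet_eq] at e1
  rw [← h'.valueSet_eq, ← heq] at e2
  have hr : r ∉ valueSet ψ := by
    simp only [valueSet, Finset.mem_image, not_exists, not_and]
    exact fun i _ => (ψ i).2
  have hd : IsParentFun (W \ valueSet ψ) r (detach (valueSet ψ) p) := by
    refine hp.detach hr ?_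
    rw [h.valueSet_eq]
    exact fringe_closed p w
  have hdisj : ∀ x, IsBelow p u x → x ∉ valueSet ψ := by
    rw [h.valueSet_eq]
    intro x hx hx'
    have hw := mem_twins.1 hw
    exact hp.disjoint_of_siblings hu hw.2.1 hw.1.symm hw.2.2.1.symm ⟨hx, mem_fringe.1 hx'⟩
  have hdisj' : ∀ x, IsBelow q u' x → x ∉ valueSet ψ := by
    rw [h'.valueSet_eq]
    intro x hx hx'
    have hw := mem_twins.1 hw'
    exact hq.disjoint_of_siblings hu' hw.2.1 hw.1.symm hw.2.2.1.symm ⟨hx, mem_fringe.1 hx'⟩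
  have hvs := h.valueSet_eq
  have hvs' := h'.valueSet_eq
  obtain ⟨f, hf, hk, hψ⟩ := h
  obtain ⟨g, hg, hk', hψ'⟩ := h'
  -- In the remaining tree `u` is the only vertex above `v` with exactly `k` descendants.
  have huu : u = u' := by
    refine hd.eq_of_card_fringe_eq (x := v) ?_ ?_ (by rw [e1, e2, hk, hk'])
    · rw [← mem_fringe, e1, mem_fringe]; exact hv
    · rw [← mem_fringe, e2, mem_fringe]; exact hv'
  subst huu
  have hff : fringe p u = fringe q u := e1.symm.trans e2
  have hfg : ∀ x, IsBelow p u x → f x = g x := by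
    intro x hx
    have hx1 : x ∈ fringe p u := mem_fringe.2 hx
    have h1 := hψ (Finset.equivFinOfCardEq hk ⟨x, hx1⟩)
    have h2 := hψ' (Finset.equivFinOfCardEq hk ⟨x, hx1⟩)
    -- The chosen enumeration depends only on the set, so equal fringe sets are listed in the same
    -- order and `ψ` determines the isomorphism.
    have key : ∀ (s t : Finset V) (hs : s.card = k) (ht : t.card = k) (hst : s = t) (hx : x ∈ s),
        ((Finset.equivFinOfCardEq ht).symm (Finset.equivFinOfCardEq hs ⟨x, hx⟩) : V) = x := by
      intro s t hs ht hst hx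
      subst hst
      simp
    rw [key _ _ hk hk' hff hx1] at h2
    rw [key _ _ hk hk rfl hx1] at h1
    exact h1.symm.trans h2
  have hpq : ∀ x, x ∉ valueSet ψ → p x = q x := by
    intro x hx
    rw [← detach_of_notMem (p := p) hx, heq, detach_of_notMem hx]
  have hww : w = w' := by
    rw [← hf.map_root, ← hg.map_root]
    exact hfg u (.refl _ _)
  -- On the deleted vertices the parent function is transported from the fringe subtree at `u`, and
  -- the twin hangs from the parent of `u`.
  refine ⟨?_, rfl, hww⟩
  funext y
  by_cases hy : y ∈ valueSet ψ
  · rw [hvs, mem_fringe] at hy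
    obtain ⟨x, hx, rfl⟩ := hf.surj y hy
    by_cases hxu : x = u
    · subst hxu
      have h1 := (mem_twins.1 hw).2.2.1
      have h2 := (mem_twins.1 hw').2.2.1
      rw [hf.map_root, h1, hpq x (hdisj x hx), ← h2, hww]
    · have hxq : IsBelow q u x := by rw [← mem_fringe, ← hff, mem_fringe]; exact hx
      rw [← hf.map_parent x hx hxu, hfg _ (hx.parent_of_ne hxu), hpq x (hdisj x hx),
        hg.map_parent x hxq hxu, hfg x hx]
  · exact hpq y hy

-- A configuration is encoded by the list of the vertices of the twin branch, ordered through the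
-- isomorphism with the branch at `u`, and by the rest of the tree with its path. The root is never
-- listed, hence the falling factorial of n - 1.
open Classical in
theorem card_twinConfigs_le (r : V) (k : ℕ) :
    (twinConfigs r k).card ≤
      (Fintype.card V - 1).descFactorial k * pathTotal (Fintype.card V - k) := by
  let tgt : Finset (Σ _ : Fin k ↪ {x : V // x ≠ r}, Σ _ : V → V, V × V × V) :=
    Finset.univ.sigma fun ψ => (parentFuns (Finset.univ \ valueSet ψ) r).sigma fun q => pathSlots q
  have htgt : tgt.card =
      (Fintype.card V - 1).descFactorial k * pathTotal (Fintype.card V - k) := by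
    have hinner : ∀ ψ : Fin k ↪ {x : V // x ≠ r},
        ((parentFuns (Finset.univ \ valueSet ψ) r).sigma fun q => pathSlots q).card =
        pathTotal (Fintype.card V - k) := by
      intro ψ
      rw [Finset.card_sigma, sum_card_pathSlots, Finset.card_sdiff_of_subset
        (Finset.subset_univ _), card_valueSet, Finset.card_univ]
      simp only [valueSet, Finset.mem_sdiff, Finset.mem_univ, Finset.mem_image, true_and,
        not_exists]
      exact fun i => (ψ i).2
    rw [Finset.card_sigma, Finset.sum_congr rfl fun ψ _ => hinner ψ, Finset.sum_const,
      Finset.card_univ, Fintype.card_embedding_eq, Fintype.card_fin, smul_eq_mul]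
    congr 2
    rw [Fintype.card_subtype_compl, Fintype.card_subtype_eq]
  rw [← htgt]
  refine Finset.card_le_card_of_forall_subsingleton
    (fun z c => ListsTwin z.1 z.2.2.1 z.2.2.2 c.1 ∧ c.2.1 = detach (valueSet c.1) z.1 ∧
      c.2.2 = z.2.1) ?_ ?_
  · rintro ⟨p, ⟨v, a, b⟩, u, w⟩ hz
    simp only [twinConfigs, Finset.mem_filter, Finset.mem_univ, true_and] at hz
    obtain ⟨hp, hs, hu, hv, hk, hw⟩ := hz
    have htw := mem_twins.1 hw
    obtain ⟨hwu, hw2, hw3, f, hf⟩ := htw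
    obtain ⟨ψ, hψ⟩ := hf.exists_listsTwin hp hw2 hk
    have hnot : ∀ x, IsBelow p u x → x ∉ fringe p w := by
      intro x hx hx'
      exact hp.disjoint_of_siblings hu hw2 hwu.symm hw3.symm ⟨hx, mem_fringe.1 hx'⟩
    have ha : IsBelow p u a := hv.trans ⟨1, hs.parent_a⟩
    have hb : IsBelow p u b := ha.trans ⟨1, hs.parent_b⟩
    refine ⟨⟨ψ, detach (valueSet ψ) p, (v, a, b)⟩, ?_, hψ, rfl, rfl⟩
    simp only [tgt, Finset.mem_sigma, Finset.mem_univ, true_and, mem_parentFuns, mem_pathSlots]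
    rw [hψ.valueSet_eq]
    refine ⟨hp.detach ?_ (fringe_closed p w), hs.detach (hnot v hv) (hnot a ha) (hnot b hb)⟩
    rw [mem_fringe, hp.isBelow_iff_eq_of_root]
    rintro rfl
    exact hw2 hp.root
  · rintro ⟨ψ, q, t⟩ _ ⟨p, ⟨v, a, b⟩, u, w⟩ hz ⟨p', ⟨v', a', b'⟩, u', w'⟩ hz'
    simp only [twinConfigs, Finset.mem_filter, Finset.mem_univ, true_and, Set.mem_ofPred_eq]
      at hz hz'
    obtain ⟨⟨hp, hs, hu, hv, hk, hw⟩, hl, rfl, rfl⟩ := hz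
    obtain ⟨⟨hp', hs', hu', hv', hk', hw'⟩, hl', heq, ht⟩ := hz'
    simp only [Prod.mk.injEq] at ht
    obtain ⟨rfl, rfl, rfl⟩ := ht
    obtain ⟨rfl, rfl, rfl⟩ :=
      eq_of_listsTwin_of_detach_eq hp hp' hu hu' hw hw' hv hv' hl hl' heq
    rfl

/-- For m = j + 5 the common factors cancel, leaving 2(j + 1) ^ (j + 1) ≤ (j + 2) ^ (j + 1). -/
theorem two_mul_pathTotal_le (m : ℕ) : 2 * ((m - 1) * pathTotal (m - 1)) ≤ pathTotal m := by
  rcases Nat.lt_or_ge m 5 with h | h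
  · interval_cases m <;> decide
  · obtain ⟨j, rfl⟩ : ∃ j, m = j + 5 := ⟨m - 5, by omega⟩
    have h1 : 2 * (j + 1) ^ (j + 1) ≤ (j + 2) ^ (j + 1) := by
      -- Bernoulli's inequality for (1 + 1/(j + 1)) ^ n with denominators cleared; it is needed at n
      -- = j + 1.
      have h2 : ∀ n : ℕ, (j + 1) ^ n * (j + 1 + n) ≤ (j + 1) * (j + 2) ^ n := by
        intro n
        induction n with
        | zero => simp
        | succ n ih =>
          calc (j + 1) ^ (n + 1) * (j + 1 + (n + 1))
              ≤ (j + 2) * ((j + 1) ^ n * (j + 1 + n)) := by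
                rw [pow_succ]
                nlinarith [Nat.zero_le ((j + 1) ^ n * n)]
            _ ≤ (j + 2) * ((j + 1) * (j + 2) ^ n) := Nat.mul_le_mul_left _ ih
            _ = (j + 1) * (j + 2) ^ (n + 1) := by ring
      have h3 := h2 (j + 1)
      refine Nat.le_of_mul_le_mul_left (?_ : (j + 1) * _ ≤ (j + 1) * _) (Nat.succ_pos j)
      linarith
    simp only [pathTotal, show j + 5 - 1 = j + 4 by omega, show j + 4 - 1 = j + 3 by omega,
      show j + 4 - 2 = j + 2 by omega, show j + 4 - 3 = j + 1 by omega,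
      show j + 4 - 4 = j by omega, show j + 5 - 2 = j + 3 by omega,
      show j + 5 - 3 = j + 2 by omega, show j + 5 - 4 = j + 1 by omega]
    calc 2 * ((j + 4) * ((j + 3) * (j + 2) * (j + 1) * (j + 1) ^ j))
        = (j + 4) * (j + 3) * (j + 2) * (2 * (j + 1) ^ (j + 1)) := by ring
      _ ≤ (j + 4) * (j + 3) * (j + 2) * (j + 2) ^ (j + 1) := Nat.mul_le_mul_left _ h1

theorem descFactorial_mul_pathTotal_le (n k : ℕ) :
    2 ^ k * ((n - 1).descFactorial k * pathTotal (n - k)) ≤ pathTotal n := by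
  induction k with
  | zero => simp
  | succ k ih =>
    refine le_trans ?_ ih
    have h := two_mul_pathTotal_le (n - k)
    have e1 : n - 1 - k = n - k - 1 := by omega
    have e2 : n - (k + 1) = n - k - 1 := by omega
    rw [Nat.descFactorial_succ, e1, e2]
    calc 2 ^ (k + 1) * ((n - k - 1) * (n - 1).descFactorial k * pathTotal (n - k - 1))
        = 2 ^ k * ((n - 1).descFactorial k *
          (2 * ((n - k - 1) * pathTotal (n - k - 1)))) := by ring
      _ ≤ _ := Nat.mul_le_mul_left _ (Nat.mul_le_mul_left _ h)

open Classical in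
/-- Twins of vertices above path slots are rare. -/
theorem four_mul_sum_card_twins_le (r : V) :
    4 * ∑ p ∈ parentFuns Finset.univ r, ∑ t ∈ pathSlots p,
      ∑ u with p u ≠ u ∧ IsBelow p u t.1, ((twins p u).card : ℝ) ≤
      (pathTotal (Fintype.card V) : ℝ) := by
  set n := Fintype.card V
  have h1 : ∑ p ∈ parentFuns Finset.univ r, ∑ t ∈ pathSlots p,
      ∑ u with p u ≠ u ∧ IsBelow p u t.1, ((twins p u).card : ℝ) =
      ∑ k ∈ Finset.range (n + 1), ((twinConfigs r k).card : ℝ) := by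
    have h2 : ∀ k ∈ Finset.range (n + 1), ((twinConfigs r k).card : ℝ) =
        ∑ p ∈ parentFuns Finset.univ r, ∑ t ∈ pathSlots p,
        ∑ u with p u ≠ u ∧ IsBelow p u t.1,
          if (fringe p u).card = k then ((twins p u).card : ℝ) else 0 := by
      intro k _
      have h3 : (twinConfigs r k).card = ((parentFuns Finset.univ r).sigma fun p =>
          (pathSlots p).sigma fun t =>
          (Finset.univ.filter fun u => p u ≠ u ∧ IsBelow p u t.1).sigma fun u =>
          if (fringe p u).card = k then twins p u else ∅).card := by
        refine Finset.card_nbij' (fun z => ⟨z.1, z.2.1, z.2.2.1, z.2.2.2⟩)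
          (fun z => (z.1, z.2.1, z.2.2.1, z.2.2.2)) ?_ ?_ (fun _ _ => rfl) (fun _ _ => rfl)
        · rintro ⟨p, t, u, w⟩ hz
          simp only [twinConfigs, Finset.coe_filter, Finset.mem_univ, true_and,
            Set.mem_ofPred_eq] at hz
          simp only [Finset.coe_sigma, Set.mem_sigma_iff, Finset.mem_coe, mem_parentFuns,
            mem_pathSlots, Finset.mem_filter, Finset.mem_univ, true_and]
          rw [if_pos hz.2.2.2.2.1]
          exact ⟨hz.1, hz.2.1, ⟨hz.2.2.1, hz.2.2.2.1⟩, hz.2.2.2.2.2⟩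
        · rintro ⟨p, t, u, w⟩ hz
          simp only [Finset.coe_sigma, Set.mem_sigma_iff, Finset.mem_coe, mem_parentFuns,
            mem_pathSlots, Finset.mem_filter, Finset.mem_univ, true_and] at hz
          simp only [twinConfigs, Finset.coe_filter, Finset.mem_univ, true_and,
            Set.mem_ofPred_eq]
          obtain ⟨g1, g2, ⟨g3, g4⟩, g5⟩ := hz
          by_cases hk : (fringe p u).card = k
          · rw [if_pos hk] at g5
            exact ⟨g1, g2, g3, g4, hk, g5⟩
          · rw [if_neg hk] at g5
            exact absurd g5 (Finset.notMem_empty w)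
      rw [h3]
      simp only [Finset.card_sigma]
      push_cast
      refine Finset.sum_congr rfl fun p _ => Finset.sum_congr rfl fun t _ =>
        Finset.sum_congr rfl fun u _ => ?_
      split_ifs <;> simp
    rw [Finset.sum_congr rfl h2, Finset.sum_comm]
    refine Finset.sum_congr rfl fun p _ => ?_
    rw [Finset.sum_comm]
    refine Finset.sum_congr rfl fun t _ => ?_
    rw [Finset.sum_comm]
    refine Finset.sum_congr rfl fun u _ => ?_
    rw [Finset.sum_ite_eq, if_pos]
    exact Finset.mem_range.2 (Nat.lt_succ_of_le (Finset.card_le_univ _))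
  -- Sizes below 3 do not occur, since the branch at `u` contains the path.
  have h4 : ∀ k ∈ Finset.range (n + 1), ((twinConfigs r k).card : ℝ) ≤
      if 3 ≤ k then (pathTotal n : ℝ) * (1 / 2) ^ k else 0 := by
    intro k _
    split_ifs with hk
    · have h5 := (Nat.mul_le_mul_left (2 ^ k) (card_twinConfigs_le r k)).trans
        (descFactorial_mul_pathTotal_le n k)
      have h6 : (2 : ℝ) ^ k * (twinConfigs r k).card ≤ pathTotal n := by exact_mod_cast h5
      rw [one_div, inv_pow, ← div_eq_mul_inv, le_div_iff₀ (by positivity), mul_comm]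
      exact h6
    · have : twinConfigs r k = ∅ := by
        refine Finset.filter_eq_empty_iff.2 ?_
        rintro ⟨p, t, u, w⟩ _ ⟨_, hs, _, hv, hc, _⟩
        exact hk (hc ▸ hs.three_le_card_fringe hv)
      rw [this]
      simp
  have h7 : ∑ k ∈ Finset.range (n + 1),
      (if 3 ≤ k then (pathTotal n : ℝ) * (1 / 2) ^ k else 0) ≤ (pathTotal n : ℝ) * (1 / 4) := by
    -- The geometric series from k = 3 has sum 1/4; subtracting its tail 2 · (1/2) ^ m makes the
    -- induction close.
    have h8 : ∀ m : ℕ, ∑ k ∈ Finset.range m, (if 3 ≤ k then (1 / 2 : ℝ) ^ k else 0) ≤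
        1 / 4 - (if 3 ≤ m then 2 * (1 / 2 : ℝ) ^ m else 0) := by
      intro m
      induction m with
      | zero => norm_num
      | succ m ih =>
        rw [Finset.sum_range_succ]
        rcases Nat.lt_trichotomy m 2 with h | h | h
        · rw [if_neg (by omega)] at ih ⊢
          rw [if_neg (by omega)]
          linarith
        · subst h
          norm_num [Finset.sum_range_succ]
        · rw [if_pos (by omega)] at ih ⊢
          rw [if_pos (by omega), pow_succ]
          linarith
    have h9 := h8 (n + 1)
    have h10 : (0 : ℝ) ≤ if 3 ≤ n + 1 then 2 * (1 / 2 : ℝ) ^ (n + 1) else 0 := by positivity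
    calc _ = (pathTotal n : ℝ) * ∑ k ∈ Finset.range (n + 1),
          (if 3 ≤ k then (1 / 2 : ℝ) ^ k else 0) := by
          rw [Finset.mul_sum]
          exact Finset.sum_congr rfl fun k _ => by split_ifs <;> simp
      _ ≤ _ := mul_le_mul_of_nonneg_left (by linarith) (Nat.cast_nonneg _)
  rw [h1]
  have := (Finset.sum_le_sum h4).trans h7
  linarith

end Twins

/-! ### Trees as graphs and trees as parent functions. -/

section ParentGraph

variable {V : Type} {W S : Finset V} {r u v w x y a b : V} {p q f : V → V}

/-- The graph in which every vertex is adjacent to its parent. -/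
def parentGraph (p : V → V) : SimpleGraph V := SimpleGraph.fromRel fun x y => p x = y

theorem parentGraph_adj : (parentGraph p).Adj x y ↔ x ≠ y ∧ (p x = y ∨ p y = x) :=
  SimpleGraph.fromRel_adj _ x y

theorem parentGraph_adj_parent (h : p x ≠ x) : (parentGraph p).Adj x (p x) :=
  parentGraph_adj.2 ⟨h.symm, .inl rfl⟩

/-- An injective map of graphs from one fringe subtree to another that preserves the roots respects
parents. -/
theorem map_parent_of_adj (hp : IsParentFun W r p) (hq : IsParentFun S y q)
    (hfu : f u = w) (hfw : ∀ x, IsBelow p u x → IsBelow q w (f x))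
    (hinj : ∀ x y, IsBelow p u x → IsBelow p u y → f x = f y → x = y)
    (hadj : ∀ x y, IsBelow p u x → IsBelow p u y → (parentGraph p).Adj x y →
      (parentGraph q).Adj (f x) (f y))
    (hx : IsBelow p u x) (hxu : x ≠ u) : f (p x) = q (f x) := by
  refine hx.induction (P := fun x => x ≠ u → f (p x) = q (f x)) (fun h => absurd rfl h)
    (fun x hxu hx ih _ => ?_) hxu
  have hpx : IsBelow p u (p x) := hx.parent_of_ne hxu
  have hne : p x ≠ x := by
    intro h
    obtain ⟨k, hk⟩ := hx
    exact hxu (by rw [← hk, Function.iterate_fixed h])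
  rcases (parentGraph_adj.1 (hadj _ _ hx hpx (parentGraph_adj_parent hne))).2 with h | h
  · exact h.symm
  -- Here `f x` would be the parent of `f (p x)`. If `p x = u`, a vertex below `w` would be the
  -- parent of `w`, forcing `q w = w`; otherwise the induction hypothesis and injectivity give `p (p
  -- x) = x`.
  · exfalso
    by_cases hpu : p x = u
    · rw [hpu, hfu] at h
      have h1 := hfw x hx
      rw [← h] at h1
      have h2 : q w = w := by
        by_contra h3
        exact hq.not_isBelow_parent h3 h1
      exact hxu (hinj _ _ hx (.refl _ _) (by rw [hfu, ← h, h2]))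
    · have h1 := ih hpu
      rw [h] at h1
      exact hp.parent_parent_ne hne (hinj _ _ (hpx.parent_of_ne hpu) hx h1)

theorem IsFringeIso.adj_iff (hp : IsParentFun W r p) (hq : IsParentFun S a q)
    (hf : IsFringeIso p q u w f) (hx : IsBelow p u x) (hy : IsBelow p u y) :
    (parentGraph q).Adj (f x) (f y) ↔ (parentGraph p).Adj x y := by
  have h1 : ∀ x y, IsBelow p u x → IsBelow p u y → x ≠ y → (p x = y ↔ q (f x) = f y) := by
    intro x y hx hy hxy
    by_cases hxu : x = u
    · subst hxu
      constructor
      · intro h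
        exact absurd (h ▸ hy) (hp.not_isBelow_parent (by rw [h]; exact hxy.symm))
      · intro h
        rw [hf.map_root] at h
        have h2 := hf.isBelow hy
        rw [← h] at h2
        refine absurd h2 (hq.not_isBelow_parent ?_)
        rw [h]
        intro h3
        exact hxy (hf.inj _ _ hx hy (by rw [hf.map_root, h3]))
    · rw [← hf.map_parent x hx hxu]
      exact ⟨fun h => by rw [h], fun h => hf.inj _ _ (hx.parent_of_ne hxu) hy h⟩
  rw [parentGraph_adj, parentGraph_adj]
  by_cases hxy : x = y
  · subst hxy
    simp
  · have hfxy : f x ≠ f y := fun h => hxy (hf.inj _ _ hx hy h)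
    rw [h1 x y hx hy hxy, h1 y x hy hx (Ne.symm hxy)]
    simp only [ne_eq, hxy, hfxy]

variable [Fintype V]

theorem parentFun_injective (hp : IsParentFun Finset.univ r p) (hq : IsParentFun Finset.univ r q)
    (h : parentGraph p = parentGraph q) : p = q := by
  funext x
  by_cases hx : x = r
  · rw [hx, hp.root, hq.root]
  · exact map_parent_of_adj (f := id) (u := r) (w := r) hp hq rfl
      (fun x _ => hq.isBelow_root (Finset.mem_univ _)) (fun _ _ _ _ h => h)
      (fun x y _ _ hxy => h ▸ hxy) (hp.isBelow_root (Finset.mem_univ x)) hx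

namespace IsParentFun

theorem reachable (hp : IsParentFun Finset.univ r p) (x : V) : (parentGraph p).Reachable x r := by
  refine (hp.isBelow_root (Finset.mem_univ x)).induction
    (P := fun x => (parentGraph p).Reachable x r) (SimpleGraph.Reachable.refl _) ?_
  intro y hy _ h
  exact (parentGraph_adj_parent (hp.parent_ne (Finset.mem_univ y) hy)).reachable.trans h

theorem connected (hp : IsParentFun Finset.univ r p) : (parentGraph p).Connected :=
  have : Nonempty V := ⟨r⟩
  ⟨fun x y => (hp.reachable x).trans (hp.reachable y).symm⟩

/-- The graph is connected, and sending a non-root vertex to the edge to its parent is a bijection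
onto the edges, so there is one edge fewer than vertices. -/
theorem isTree_parentGraph (hp : IsParentFun Finset.univ r p) : (parentGraph p).IsTree := by
  classical
  refine SimpleGraph.isTree_iff_connected_and_card.2 ⟨hp.connected, ?_⟩
  have hedge : (parentGraph p).edgeSet =
      (fun v => s(v, p v)) '' ((Finset.univ.erase r : Finset V) : Set V) := by
    ext e
    induction e with
    | _ x y =>
    rw [SimpleGraph.mem_edgeSet, parentGraph_adj, Set.mem_image]
    constructor
    · rintro ⟨hne, h | h⟩
      · refine ⟨x, ?_, by rw [h]⟩
        simp only [Finset.coe_erase, Finset.coe_univ, Set.mem_sdiff, Set.mem_univ, true_and,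
          Set.mem_singleton_iff]
        rintro rfl
        exact hne (hp.root.symm.trans h)
      · refine ⟨y, ?_, by rw [h, Sym2.eq_swap]⟩
        simp only [Finset.coe_erase, Finset.coe_univ, Set.mem_sdiff, Set.mem_univ, true_and,
          Set.mem_singleton_iff]
        rintro rfl
        exact hne (h.symm.trans hp.root)
    · rintro ⟨v, hv, h⟩
      have hvr : p v ≠ v := hp.parent_ne (Finset.mem_univ v) (by simpa using hv)
      rw [Sym2.eq_iff] at h
      rcases h with ⟨rfl, rfl⟩ | ⟨rfl, rfl⟩
      · exact ⟨hvr.symm, .inl rfl⟩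
      · exact ⟨hvr, .inr rfl⟩
  have hinj : Set.InjOn (fun v => s(v, p v)) ((Finset.univ.erase r : Finset V) : Set V) := by
    intro v hv w _ h
    have hvr : p v ≠ v := hp.parent_ne (Finset.mem_univ v) (by simpa using hv)
    rw [Sym2.eq_iff] at h
    rcases h with ⟨h, _⟩ | ⟨h1, h2⟩
    · exact h
    · exact absurd (by rw [h2, ← h1]) (hp.parent_parent_ne hvr)
  rw [hedge, Nat.card_image_of_injOn hinj, Nat.card_coe_set_eq, Set.ncard_coe_finset,
    Finset.card_erase_add_one (Finset.mem_univ r), Finset.card_univ, Nat.card_eq_fintype_card]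

theorem exists_path_to_root (hp : IsParentFun Finset.univ r p) (x : V) :
    ∃ w : (parentGraph p).Walk x r, w.IsPath ∧ ∀ z, z ∈ w.support ↔ IsBelow p z x := by
  refine (hp.isBelow_root (Finset.mem_univ x)).induction
    (P := fun x => ∃ w : (parentGraph p).Walk x r, w.IsPath ∧
      ∀ z, z ∈ w.support ↔ IsBelow p z x) ?_ ?_
  · refine ⟨.nil, SimpleGraph.Walk.IsPath.nil, fun z => ?_⟩
    rw [SimpleGraph.Walk.support_nil, List.mem_singleton, hp.isBelow_iff_eq_of_root]
  · rintro y hy _ ⟨w, hw, hz⟩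
    have hne := hp.parent_ne (Finset.mem_univ y) hy
    refine ⟨.cons (parentGraph_adj_parent hne) w, ?_, fun z => ?_⟩
    · rw [SimpleGraph.Walk.cons_isPath_iff, hz]
      exact ⟨hw, hp.not_isBelow_parent hne⟩
    · rw [SimpleGraph.Walk.support_cons, List.mem_cons, hz]
      constructor
      · rintro (rfl | h)
        · exact .refl _ _
        · exact h.trans (isBelow_parent p y)
      · intro h
        by_cases hyz : y = z
        · exact .inl hyz.symm
        · exact .inr (h.parent_of_ne hyz)

theorem exists_path_iff_isBelow (hp : IsParentFun Finset.univ r p) :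
    (∃ d : (parentGraph p).Walk r x, d.IsPath ∧ u ∈ d.support) ↔ IsBelow p u x := by
  obtain ⟨c, hc, hz⟩ := hp.exists_path_to_root x
  rw [← hz]
  constructor
  · rintro ⟨d, hd, hu⟩
    have := congrArg Subtype.val
      ((hp.isTree_parentGraph.isAcyclic.subsingleton_path x r).elim ⟨c, hc⟩
        ⟨d.reverse, hd.reverse⟩)
    dsimp only at this
    rw [this, SimpleGraph.Walk.support_reverse, List.mem_reverse]
    exact hu
  · intro hu
    exact ⟨c.reverse, hc.reverse, by rwa [SimpleGraph.Walk.support_reverse, List.mem_reverse]⟩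

end IsParentFun

/-- Take as parent a neighbour closer to the root. The resulting graph is a connected spanning
subgraph of `G`, and a tree is minimal among connected graphs. -/
theorem exists_parentFun {G : SimpleGraph V} (hG : G.IsTree) (r : V) :
    ∃ p, IsParentFun Finset.univ r p ∧ parentGraph p = G := by
  classical
  have h1 : ∀ v, v ≠ r → ∃ w, G.Adj v w ∧ G.dist w r < G.dist v r := by
    intro v hv
    obtain ⟨w, hw⟩ := hG.connected.exists_walk_length_eq_dist v r
    cases w with
    | nil => exact absurd rfl hv
    | cons h w' =>
      refine ⟨_, h, ?_⟩
      rw [SimpleGraph.Walk.length_cons] at hw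
      exact lt_of_le_of_lt (SimpleGraph.dist_le w') (by omega)
  choose g hg using h1
  let p : V → V := fun v => if h : v = r then r else g v h
  have hpr : p r = r := dif_pos rfl
  have hpv : ∀ v (h : v ≠ r), p v = g v h := fun v h => dif_neg h
  have hp : IsParentFun Finset.univ r p := by
    refine ⟨Finset.mem_univ r, hpr, fun v hv => absurd (Finset.mem_univ v) hv, fun v _ => ?_⟩
    induction hd : G.dist v r using Nat.strong_induction_on generalizing v with
    | _ d ih =>
      by_cases h : v = r
      · exact ⟨0, h⟩
      · have h2 := (hg v h).2
        obtain ⟨k, hk⟩ := ih _ (hd ▸ h2) (g v h) (Finset.mem_univ _) rfl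
        exact ⟨k + 1, by rw [Function.iterate_succ_apply, hpv v h, hk]⟩
  refine ⟨p, hp, ?_⟩
  have hle : parentGraph p ≤ G := by
    intro x y hxy
    rw [parentGraph_adj] at hxy
    obtain ⟨hne, h⟩ := hxy
    rcases h with h | h
    · by_cases hx : x = r
      · exact absurd (by rw [← h, hx, hpr]) hne
      · rw [← h, hpv x hx]; exact (hg x hx).1
    · by_cases hy : y = r
      · exact absurd (by rw [← h, hy, hpr]) hne
      · rw [← h, hpv y hy]; exact (hg y hy).1.symm
  exact le_antisymm hle ((SimpleGraph.isTree_iff_minimal_connected.1 hG).2 hp.connected hle)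

end ParentGraph

/-! ### Isomorphism types of fringe subtrees. -/

section RootedIso

variable {V W X : Type} {G : SimpleGraph V} {H : SimpleGraph W} {K : SimpleGraph X}
  {r : V} {s : W} {t : X}

theorem RootedIso.symm (h : RootedIso G r H s) : RootedIso H s G r := by
  obtain ⟨e, rfl⟩ := h
  exact ⟨e.symm, e.symm_apply_apply r⟩

theorem RootedIso.trans (h : RootedIso G r H s) (h' : RootedIso H s K t) : RootedIso G r K t := by
  obtain ⟨e, rfl⟩ := h
  obtain ⟨e', rfl⟩ := h'
  exact ⟨e.trans e', rfl⟩

end RootedIso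

namespace LabelledTree

variable {n : ℕ} {r i v w : Fin n}

/-- The parent function of the labelled tree `T` with root `r`. -/
noncomputable def parentFun (T : LabelledTree n) (r : Fin n) : Fin n → Fin n :=
  (exists_parentFun T.isTree r).choose

theorem isParentFun (T : LabelledTree n) (r : Fin n) :
    IsParentFun Finset.univ r (T.parentFun r) :=
  (exists_parentFun T.isTree r).choose_spec.1

theorem parentGraph_parentFun (T : LabelledTree n) (r : Fin n) :
    parentGraph (T.parentFun r) = T.graph :=
  (exists_parentFun T.isTree r).choose_spec.2

/-- Labelled trees correspond to parent functions. -/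
noncomputable def equivParentFuns (r : Fin n) :
    LabelledTree n ≃ {p // p ∈ parentFuns (Finset.univ : Finset (Fin n)) r} where
  toFun T := ⟨T.parentFun r, mem_parentFuns.2 (T.isParentFun r)⟩
  invFun p := ⟨parentGraph p, (mem_parentFuns.1 p.2).isTree_parentGraph⟩
  left_inv T := Subtype.ext (T.parentGraph_parentFun r)
  right_inv p := Subtype.ext (parentFun_injective (isParentFun _ r) (mem_parentFuns.1 p.2)
    (parentGraph_parentFun _ r))

theorem mem_descendants_iff (T : LabelledTree n) :
    w ∈ T.descendants r v ↔ IsBelow (T.parentFun r) v w := by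
  have h := (T.isParentFun r).exists_path_iff_isBelow (u := v) (x := w)
  rwa [T.parentGraph_parentFun r] at h

theorem descendants_eq (T : LabelledTree n) :
    T.descendants r v = (fringe (T.parentFun r) v : Set (Fin n)) := by
  ext w
  rw [mem_descendants_iff, Finset.mem_coe, mem_fringe]

theorem isChild_iff (T : LabelledTree n) :
    T.IsChild r i v ↔ T.parentFun r v ≠ v ∧ T.parentFun r v = i := by
  rw [IsChild, mem_descendants_iff, ← T.parentGraph_parentFun r, parentGraph_adj]
  constructor
  · rintro ⟨⟨hne, h | h⟩, hb⟩
    · rw [← h] at hb hne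
      exact absurd hb ((T.isParentFun r).not_isBelow_parent hne.symm)
    · exact ⟨by rw [h]; exact hne, h⟩
  · rintro ⟨h, rfl⟩
    exact ⟨⟨h, .inr rfl⟩, isBelow_parent _ _⟩

theorem rootedIso_induce_iff (T U : LabelledTree n) :
    RootedIso (T.graph.induce (T.descendants r v)) ⟨v, T.self_mem_descendants r v⟩
      (U.graph.induce (U.descendants r w)) ⟨w, U.self_mem_descendants r w⟩ ↔
    ∃ f, IsFringeIso (T.parentFun r) (U.parentFun r) v w f := by
  classical
  have hT := T.isParentFun r
  have hU := U.isParentFun r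
  constructor
  · rintro ⟨e, he⟩
    let f : Fin n → Fin n := fun x => if h : x ∈ T.descendants r v then e ⟨x, h⟩ else x
    have hf : ∀ x (h : x ∈ T.descendants r v), f x = e ⟨x, h⟩ := fun x h => dif_pos h
    have hfv : f v = w := by rw [hf v (T.self_mem_descendants r v), he]
    have hinj : ∀ x y, IsBelow (T.parentFun r) v x → IsBelow (T.parentFun r) v y →
        f x = f y → x = y := by
      intro x y hx hy h
      rw [← mem_descendants_iff] at hx hy
      rw [hf x hx, hf y hy] at h
      exact Subtype.mk.inj (e.injective (Subtype.ext h))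
    refine ⟨f, hfv, fun x hx hxv => ?_, hinj, ?_⟩
    · refine map_parent_of_adj hT hU hfv ?_ hinj ?_ hx hxv
      · intro x hx
        rw [← mem_descendants_iff] at hx ⊢
        rw [hf x hx]
        exact (e _).2
      · intro x y hx hy hxy
        rw [← mem_descendants_iff] at hx hy
        rw [parentGraph_parentFun] at hxy ⊢
        rw [hf x hx, hf y hy]
        exact (e.map_adj_iff (v := ⟨x, hx⟩) (w := ⟨y, hy⟩)).2 hxy
    · intro y hy
      rw [← mem_descendants_iff] at hy
      refine ⟨e.symm ⟨y, hy⟩, ?_, ?_⟩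
      · rw [← mem_descendants_iff]
        exact (e.symm ⟨y, hy⟩).2
      · rw [hf _ (e.symm ⟨y, hy⟩).2]
        simp
  · rintro ⟨f, hf⟩
    have hmaps : ∀ x : T.descendants r v, f x ∈ U.descendants r w := fun x => by
      rw [mem_descendants_iff]
      exact hf.isBelow (T.mem_descendants_iff.1 x.2)
    let g : T.descendants r v → U.descendants r w := fun x => ⟨f x, hmaps x⟩
    have hg : Function.Bijective g := by
      constructor
      · intro x y h
        exact Subtype.ext (hf.inj _ _ (T.mem_descendants_iff.1 x.2) (T.mem_descendants_iff.1 y.2)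
          (Subtype.mk.inj h))
      · rintro ⟨y, hy⟩
        obtain ⟨x, hx, hxy⟩ := hf.surj y (U.mem_descendants_iff.1 hy)
        exact ⟨⟨x, T.mem_descendants_iff.2 hx⟩, Subtype.ext hxy⟩
    refine ⟨⟨Equiv.ofBijective g hg, ?_⟩, Subtype.ext hf.map_root⟩
    intro x y
    have := hf.adj_iff hT hU (T.mem_descendants_iff.1 x.2) (T.mem_descendants_iff.1 y.2)
    rw [parentGraph_parentFun, parentGraph_parentFun] at this
    exact this

theorem isTree_induce_descendants (T : LabelledTree n) (r v : Fin n) :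
    (T.graph.induce (T.descendants r v)).IsTree := by
  have : Nonempty (T.descendants r v) := ⟨⟨v, T.self_mem_descendants r v⟩⟩
  refine ⟨⟨?_⟩, T.isTree.isAcyclic.induce _⟩
  have key : ∀ x, IsBelow (T.parentFun r) v x → ∀ hx : x ∈ T.descendants r v,
      (T.graph.induce (T.descendants r v)).Reachable ⟨x, hx⟩ ⟨v, T.self_mem_descendants r v⟩ := by
    intro x hx
    refine hx.induction (P := fun x => ∀ hx : x ∈ T.descendants r v,
      (T.graph.induce (T.descendants r v)).Reachable ⟨x, hx⟩ ⟨v, T.self_mem_descendants r v⟩)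
      (fun _ => SimpleGraph.Reachable.refl _) ?_
    intro y hy hb ih hyd
    have h1 : T.parentFun r y ∈ T.descendants r v := by
      rw [mem_descendants_iff]
      exact hb.parent_of_ne hy
    refine SimpleGraph.Reachable.trans (SimpleGraph.Adj.reachable ?_) (ih h1)
    change T.graph.Adj y (T.parentFun r y)
    rw [← T.parentGraph_parentFun r]
    apply parentGraph_adj_parent
    intro h
    obtain ⟨k, hk⟩ := hb
    exact hy (by rw [← hk, Function.iterate_fixed h])
  intro x y
  exact (key x (T.mem_descendants_iff.1 x.2) x.2).trans
    (key y (T.mem_descendants_iff.1 y.2) y.2).symm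

theorem exists_hasBranchType (T : LabelledTree n) (r v : Fin n) :
    ∃ x : Σ m, UnlabelledRootedTree m, T.HasBranchType r v x.2 := by
  classical
  let e : T.descendants r v ≃ Fin (Fintype.card (T.descendants r v)) := Fintype.equivFin _
  let G := T.graph.induce (T.descendants r v)
  let iso : G ≃g G.map e.toEmbedding := SimpleGraph.Iso.map e G
  let C : LabelledRootedTree (Fintype.card (T.descendants r v)) :=
    ⟨G.map e.toEmbedding, e ⟨v, T.self_mem_descendants r v⟩,
      iso.isTree_iff.1 (T.isTree_induce_descendants r v)⟩
  exact ⟨⟨_, Quotient.mk _ C⟩, C, rfl, iso, rfl⟩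

/-- The isomorphism type of the fringe subtree of `T` at `v`. -/
noncomputable def branchType (T : LabelledTree n) (r v : Fin n) : Σ m, UnlabelledRootedTree m :=
  (T.exists_hasBranchType r v).choose

theorem hasBranchType_branchType (T : LabelledTree n) (r v : Fin n) :
    T.HasBranchType r v (T.branchType r v).2 :=
  (T.exists_hasBranchType r v).choose_spec

theorem HasBranchType.card_eq {T : LabelledTree n} {m : ℕ} {B : UnlabelledRootedTree m}
    (h : T.HasBranchType r v B) : (fringe (T.parentFun r) v).card = m := by
  obtain ⟨C, _, e, _⟩ := h
  have := Nat.card_congr e.toEquiv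
  rw [descendants_eq, Nat.card_coe_set_eq, Set.ncard_coe_finset] at this
  rw [this, Nat.card_eq_fintype_card, Fintype.card_fin]

theorem HasBranchType.sigma_eq {T U : LabelledTree n} {m k : ℕ} {B : UnlabelledRootedTree m}
    {C : UnlabelledRootedTree k} (hB : T.HasBranchType r v B) (hC : U.HasBranchType r w C)
    (h : RootedIso (T.graph.induce (T.descendants r v)) ⟨v, T.self_mem_descendants r v⟩
      (U.graph.induce (U.descendants r w)) ⟨w, U.self_mem_descendants r w⟩) :
    (⟨m, B⟩ : Σ m, UnlabelledRootedTree m) = ⟨k, C⟩ := by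
  obtain ⟨B', rfl, hB⟩ := hB
  obtain ⟨C', rfl, hC⟩ := hC
  have h1 := (hB.symm.trans h).trans hC
  obtain rfl : m = k := by
    obtain ⟨e, _⟩ := h1
    simpa using Fintype.card_congr e.toEquiv
  congr 1
  exact Quotient.sound h1

/-- Two trees are allowed because branches are later compared before and after a bend. -/
theorem branchType_eq_iff (T U : LabelledTree n) :
    T.branchType r v = U.branchType r w ↔
      ∃ f, IsFringeIso (T.parentFun r) (U.parentFun r) v w f := by
  rw [← rootedIso_induce_iff]
  constructor
  · intro h
    have h1 := T.hasBranchType_branchType r v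
    have h2 := U.hasBranchType_branchType r w
    rw [← h] at h2
    obtain ⟨C, hC, hC'⟩ := h1
    obtain ⟨D, hD, hD'⟩ := h2
    have h3 : RootedIso C.graph C.root D.graph D.root := Quotient.exact (hC.trans hD.symm)
    exact (hC'.trans h3).trans hD'.symm
  · exact HasBranchType.sigma_eq (T.hasBranchType_branchType r v) (U.hasBranchType_branchType r w)

theorem hasBranchType_iff (T : LabelledTree n) {m : ℕ} {B : UnlabelledRootedTree m} :
    T.HasBranchType r v B ↔ T.branchType r v = ⟨m, B⟩ := by
  constructor
  · intro h
    exact HasBranchType.sigma_eq (T.hasBranchType_branchType r v) h ⟨SimpleGraph.Iso.refl, rfl⟩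
  · intro h
    have := T.hasBranchType_branchType r v
    rwa [h] at this

theorem branchType_fst (T : LabelledTree n) (r v : Fin n) :
    (T.branchType r v).1 = (fringe (T.parentFun r) v).card :=
  (T.hasBranchType_branchType r v).card_eq.symm

end LabelledTree

/-! ### Counting automorphisms that fix an ancestor-closed set. -/

section Automorphisms

variable {V : Type} {W S : Finset V} {r u v w x y a b : V} {p q f g : V → V}

theorem IsFringeIso.exists_inverse (hf : IsFringeIso p p u w f) :
    ∃ g, IsFringeIso p p w u g ∧ (∀ x, IsBelow p u x → g (f x) = x) ∧
      ∀ y, IsBelow p w y → f (g y) = y := by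
  classical
  choose! g hg using hf.surj
  have hgf : ∀ x, IsBelow p u x → g (f x) = x := by
    intro x hx
    have := hg (f x) (hf.isBelow hx)
    exact hf.inj _ _ this.1 hx this.2
  refine ⟨g, ⟨?_, ?_, ?_, ?_⟩, hgf, fun y hy => (hg y hy).2⟩
  · rw [← hf.map_root]
    exact hgf u (.refl _ _)
  · intro y hy hyw
    have h1 := hg y hy
    have hne : g y ≠ u := by
      intro h
      rw [h, hf.map_root] at h1
      exact hyw h1.2.symm
    refine hf.inj _ _ (hg _ (hy.parent_of_ne hyw)).1 (h1.1.parent_of_ne hne) ?_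
    rw [(hg _ (hy.parent_of_ne hyw)).2, hf.map_parent _ h1.1 hne, h1.2]
  · intro y z hy hz h
    rw [← (hg y hy).2, h, (hg z hz).2]
  · exact fun x hx => ⟨f x, hf.isBelow hx, hgf x hx⟩

/-- Exchange the two disjoint fringe subtrees by `f` and its inverse, and fix everything else. -/
theorem IsParentFun.exists_swap (hp : IsParentFun W r p) (hu : p u ≠ u) (hw : p w ≠ w)
    (huw : p w = p u) (hf : IsFringeIso p p u w f) :
    ∃ σ : Equiv.Perm V, (∀ x, σ (p x) = p (σ x)) ∧ σ u = w ∧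
      ∀ x, ¬ IsBelow p u x → ¬ IsBelow p w x → σ x = x := by
  classical
  by_cases hne : u = w
  · exact ⟨1, fun _ => rfl, hne, fun _ _ _ => rfl⟩
  obtain ⟨g, hg, hgf, hfg⟩ := hf.exists_inverse
  have hdisj : ∀ x, IsBelow p w x → ¬ IsBelow p u x := fun x h1 h2 =>
    hp.disjoint_of_siblings hu hw hne huw.symm ⟨h2, h1⟩
  let s : V → V := fun x => if IsBelow p u x then f x else if IsBelow p w x then g x else x
  have s1 : ∀ x, IsBelow p u x → s x = f x := fun x h => if_pos h
  have s2 : ∀ x, IsBelow p w x → s x = g x := fun x h => by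
    simp only [s, if_neg (hdisj x h), if_pos h]
  have s3 : ∀ x, ¬ IsBelow p u x → ¬ IsBelow p w x → s x = x := fun x h h' => by
    simp only [s, if_neg h, if_neg h']
  have hinv : Function.Involutive s := by
    intro x
    by_cases h1 : IsBelow p u x
    · rw [s1 x h1, s2 _ (hf.isBelow h1), hgf x h1]
    · by_cases h2 : IsBelow p w x
      · rw [s2 x h2, s1 _ (hg.isBelow h2), hfg x h2]
      · rw [s3 x h1 h2, s3 x h1 h2]
  have hpu : s (p u) = p u := s3 _ (hp.not_isBelow_parent hu) (huw ▸ hp.not_isBelow_parent hw)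
  refine ⟨hinv.toPerm s, fun x => ?_, (s1 u (.refl _ _)).trans hf.map_root, s3⟩
  change s (p x) = p (s x)
  by_cases h1 : IsBelow p u x
  · by_cases hxu : x = u
    · rw [hxu, hpu, s1 u (.refl _ _), hf.map_root, huw]
    · rw [s1 x h1, s1 _ (h1.parent_of_ne hxu), hf.map_parent x h1 hxu]
  · by_cases h2 : IsBelow p w x
    · by_cases hxw : x = w
      · rw [hxw, huw, hpu, s2 w (.refl _ _), hg.map_root]
      · rw [s2 x h2, s2 _ (h2.parent_of_ne hxw), hg.map_parent x h2 hxw]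
    · rw [s3 x h1 h2, s3 (p x) (fun h => h1 (h.trans (isBelow_parent p x)))
        (fun h => h2 (h.trans (isBelow_parent p x)))]

theorem isFringeIso_of_perm {σ : Equiv.Perm V} (hσ : ∀ x, σ (p x) = p (σ x)) (u : V) :
    IsFringeIso p p u (σ u) σ := by
  refine ⟨rfl, fun x _ _ => hσ x, fun x y _ _ h => σ.injective h, ?_⟩
  rintro y ⟨k, hk⟩
  refine ⟨σ.symm y, ⟨k, σ.injective ?_⟩, σ.apply_symm_apply y⟩
  have hit : Function.Semiconj σ p p := hσ
  rw [(hit.iterate_right k).eq, σ.apply_symm_apply, hk]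

variable [Fintype V] [DecidableEq V]

open Classical in
/-- The automorphisms of the rooted tree with parent function `p` that fix `S` pointwise. -/
noncomputable def fixingPerms (p : V → V) (S : Finset V) : Finset (Equiv.Perm V) :=
  Finset.univ.filter fun σ => (∀ x, σ (p x) = p (σ x)) ∧ ∀ x ∈ S, σ x = x

theorem mem_fixingPerms {σ : Equiv.Perm V} :
    σ ∈ fixingPerms p S ↔ (∀ x, σ (p x) = p (σ x)) ∧ ∀ x ∈ S, σ x = x := by
  classical simp [fixingPerms]

theorem fixingPerms_univ (p : V → V) : fixingPerms p Finset.univ = {1} := by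
  ext σ
  rw [mem_fixingPerms, Finset.mem_singleton]
  constructor
  · exact fun h => Equiv.ext fun x => h.2 x (Finset.mem_univ x)
  · rintro rfl
    exact ⟨fun _ => rfl, fun _ _ => rfl⟩

-- Orbit–stabilizer: as the parent of `u` is fixed, `u` can go only to a sibling of its type outside
-- `S`. Swaps reach all of these, and composing with a swap identifies each fibre with the
-- stabilizer of `u`.
open Classical in
theorem card_fixingPerms_insert {X : Type} {τ : V → X} (hp : IsParentFun Finset.univ r p)
    (hτ : ∀ v w, τ v = τ w ↔ ∃ f, IsFringeIso p p v w f)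
    (hr : r ∈ S) (hS : ∀ x ∈ S, p x ∈ S) (hu : u ∉ S) (hpu : p u ∈ S) :
    (fixingPerms p S).card =
      (Finset.univ.filter fun w => w ∉ S ∧ p w = p u ∧ τ w = τ u).card *
        (fixingPerms p (insert u S)).card := by
  have hne : ∀ w ∉ S, p w ≠ w := fun w hw =>
    hp.parent_ne (Finset.mem_univ w) fun h => hw (h ▸ hr)
  have hbelow : ∀ w ∉ S, ∀ x ∈ S, ¬ IsBelow p w x := by
    rintro w hw x hx ⟨k, rfl⟩
    apply hw
    clear hw
    induction k with
    | zero => exact hx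
    | succ k ih => rw [Function.iterate_succ_apply']; exact hS _ ih
  rw [Finset.card_eq_sum_card_fiberwise (f := fun σ : Equiv.Perm V => σ u)
    (t := Finset.univ.filter fun w => w ∉ S ∧ p w = p u ∧ τ w = τ u), Finset.sum_const_nat]
  · intro w hw
    rw [Finset.mem_filter] at hw
    obtain ⟨_, hwS, hwu, hw⟩ := hw
    obtain ⟨f, hf⟩ := (hτ u w).1 hw.symm
    obtain ⟨s, hs1, hs2, hs3⟩ := hp.exists_swap (hne u hu) (hne w hwS) hwu hf
    have hsS : ∀ x ∈ S, s x = x := fun x hx => hs3 x (hbelow u hu x hx) (hbelow w hwS x hx)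
    have hss : ∀ x, s (s⁻¹ x) = x := s.apply_symm_apply
    refine Finset.card_nbij' (fun σ => s⁻¹ * σ) (fun σ => s * σ) ?_ ?_ ?_ ?_
    · intro σ hσ
      rw [Finset.mem_coe, Finset.mem_filter, mem_fixingPerms] at hσ
      rw [Finset.mem_coe, mem_fixingPerms]
      refine ⟨fun x => ?_, fun x hx => ?_⟩
      · apply s.injective
        rw [hs1, Equiv.Perm.mul_apply, Equiv.Perm.mul_apply, hss,
          hss, hσ.1.1]
      · apply s.injective
        rw [Equiv.Perm.mul_apply, hss]
        rcases Finset.mem_insert.1 hx with rfl | hx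
        · rw [hs2, hσ.2]
        · rw [hsS x hx, hσ.1.2 x hx]
    · intro σ hσ
      rw [Finset.mem_coe, mem_fixingPerms] at hσ
      rw [Finset.mem_coe, Finset.mem_filter, mem_fixingPerms]
      refine ⟨⟨fun x => ?_, fun x hx => ?_⟩, ?_⟩
      · rw [Equiv.Perm.mul_apply, Equiv.Perm.mul_apply, hσ.1, hs1]
      · rw [Equiv.Perm.mul_apply, hσ.2 x (Finset.mem_insert_of_mem hx), hsS x hx]
      · dsimp only
        rw [Equiv.Perm.mul_apply, hσ.2 u (Finset.mem_insert_self u S), hs2]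
    · intro σ _
      simp
    · intro σ _
      simp
  · intro σ hσ
    rw [Finset.mem_coe, mem_fixingPerms] at hσ
    rw [Finset.mem_coe, Finset.mem_filter]
    refine ⟨Finset.mem_univ _, fun h => ?_, ?_, ?_⟩
    · have := σ.injective (hσ.2 _ h)
      dsimp only at h
      exact hu (this ▸ h)
    · rw [← hσ.1, hσ.2 _ hpu]
    · exact ((hτ _ _).2 ⟨σ, isFringeIso_of_perm hσ.1 u⟩).symm

-- Add to `S` one child of a fixed vertex at a time. Each addition contributes the current size of
-- its class of siblings of equal type and lowers that size by one, so the factors multiply to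
-- factorials.
open Classical in
theorem card_fixingPerms {X : Type} {τ : V → X} {s : Finset X}
    (hp : IsParentFun Finset.univ r p) (hτ : ∀ v w, τ v = τ w ↔ ∃ f, IsFringeIso p p v w f)
    (hr : r ∈ S) (hS : ∀ x ∈ S, p x ∈ S) (hs : ∀ v ∉ S, τ v ∈ s) :
    (fixingPerms p S).card = ∏ i, ∏ B ∈ s,
      (Finset.univ.filter fun v => v ∉ S ∧ p v = i ∧ τ v = B).card.factorial := by
  induction hm : Sᶜ.card generalizing S with
  | zero =>
    rw [Finset.card_eq_zero, Finset.compl_eq_empty_iff] at hm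
    rw [hm, fixingPerms_univ, Finset.card_singleton]
    simp
  | succ m ih =>
    obtain ⟨x, hx⟩ : ∃ x, x ∈ Sᶜ := Finset.card_pos.1 (by omega)
    rw [Finset.mem_compl] at hx
    obtain ⟨u, hu, hpu⟩ : ∃ u, u ∉ S ∧ p u ∈ S := by
      refine (hp.isBelow_root (Finset.mem_univ x)).induction
        (P := fun x => x ∉ S → ∃ u, u ∉ S ∧ p u ∈ S) (fun h => absurd hr h) ?_ hx
      intro y _ _ h hy
      by_cases hpy : p y ∈ S
      · exact ⟨y, hy, hpy⟩
      · exact h hpy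
    have hins := ih (S := insert u S) (Finset.mem_insert_of_mem hr) ?_ ?_ ?_
    · rw [card_fixingPerms_insert hp hτ hr hS hu hpu, hins, ← Finset.prod_product',
        ← Finset.prod_product']
      set c := (Finset.univ.filter fun w => w ∉ S ∧ p w = p u ∧ τ w = τ u).card with hc
      have hmem : (p u, τ u) ∈ (Finset.univ : Finset V) ×ˢ s :=
        Finset.mem_product.2 ⟨Finset.mem_univ _, hs u hu⟩
      rw [← Finset.mul_prod_erase _ _ hmem, ← Finset.mul_prod_erase _ _ hmem, ← mul_assoc]
      congr 1
      · have : (Finset.univ.filter fun w => w ∉ S ∧ p w = p u ∧ τ w = τ u) =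
            insert u (Finset.univ.filter fun w => w ∉ insert u S ∧ p w = p u ∧ τ w = τ u) := by
          ext w
          simp only [Finset.mem_filter, Finset.mem_univ, true_and, Finset.mem_insert, not_or]
          by_cases hwu : w = u
          · simp [hwu, hu]
          · simp [hwu]
        dsimp only
        rw [hc, this, Finset.card_insert_of_notMem (by simp), Nat.factorial_succ]
      · refine Finset.prod_congr rfl fun z hz => ?_
        rw [Finset.mem_erase] at hz
        congr 2
        refine Finset.filter_congr fun w _ => ?_
        rw [Finset.mem_insert, not_or]
        constructor
        · exact fun h => ⟨h.1.2, h.2⟩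
        · refine fun h => ⟨⟨?_, h.1⟩, h.2⟩
          rintro rfl
          exact hz.1 (Prod.ext h.2.1.symm h.2.2.symm)
    · intro x hx
      rcases Finset.mem_insert.1 hx with rfl | hx
      · exact Finset.mem_insert_of_mem hpu
      · exact Finset.mem_insert_of_mem (hS x hx)
    · exact fun v hv => hs v fun h => hv (Finset.mem_insert_of_mem h)
    · have h1 := Finset.card_compl (insert u S)
      have h2 := Finset.card_compl S
      have h3 := Finset.card_insert_of_notMem hu
      have h4 := Finset.card_le_univ (insert u S)
      omega

end Automorphisms

/-! ### The exact formula for the truncated parameter. -/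

namespace LabelledTree

variable {n : ℕ} {r i v w : Fin n}

/-- The isomorphism types of the rooted trees with at most `4 log n` vertices. -/
noncomputable def smallTypes (n : ℕ) : Finset (Σ m, UnlabelledRootedTree m) :=
  (Finset.Icc 1 ⌊4 * Real.log n⌋₊).sigma fun _ => Finset.univ

theorem branchType_mem_smallTypes_iff (T : LabelledTree n) :
    T.branchType r v ∈ smallTypes n ↔
      ((fringe (T.parentFun r) v).card : ℝ) ≤ 4 * Real.log n := by
  have hn : 0 ≤ 4 * Real.log n := by
    have := Real.log_natCast_nonneg n
    positivity
  have hpos : 1 ≤ (fringe (T.parentFun r) v).card :=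
    Finset.card_pos.2 ⟨v, mem_fringe.2 (.refl _ _)⟩
  rw [smallTypes, Finset.mem_sigma, and_iff_left (Finset.mem_univ _), branchType_fst,
    Finset.mem_Icc, and_iff_right hpos, Nat.le_floor_iff hn]

open Classical in
theorem branchCount_eq (T : LabelledTree n) (x : Σ m, UnlabelledRootedTree m) :
    T.branchCount r i x.2 = (Finset.univ.filter fun v => T.parentFun r v ≠ v ∧
      T.parentFun r v = i ∧ T.branchType r v = x).card := by
  rw [branchCount, ← Set.ncard_coe_finset]
  congr 1
  ext v
  simp only [Set.mem_ofPred_eq, Finset.coe_filter, Finset.mem_univ, true_and, isChild_iff,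
    hasBranchType_iff, and_assoc]

open Classical in
/-- The vertices fixed by all small automorphisms by definition. -/
noncomputable def largeVertices (T : LabelledTree n) (r : Fin n) : Finset (Fin n) :=
  Finset.univ.filter fun v => v = r ∨ T.IsLargeBranchRoot r v

theorem isLargeBranchRoot_iff (T : LabelledTree n) :
    T.IsLargeBranchRoot r v ↔
      v ≠ r ∧ 4 * Real.log n < ((fringe (T.parentFun r) v).card : ℝ) := by
  have hp := T.isParentFun r
  rw [IsLargeBranchRoot, descendants_eq, Set.ncard_coe_finset]
  simp only [isChild_iff, exists_and_left, exists_eq', and_true]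
  refine and_congr_left fun _ => ?_
  constructor
  · rintro h rfl
    exact h hp.root
  · exact hp.parent_ne (Finset.mem_univ v)

theorem mem_largeVertices (T : LabelledTree n) :
    v ∈ T.largeVertices r ↔
      v = r ∨ 4 * Real.log n < ((fringe (T.parentFun r) v).card : ℝ) := by
  classical
  rw [largeVertices, Finset.mem_filter, isLargeBranchRoot_iff]
  simp only [Finset.mem_univ, true_and]
  by_cases h : v = r <;> simp [h]

theorem card_autSmall (T : LabelledTree n) (r : Fin n) :
    Nat.card (T.autSmall r) = (fixingPerms (T.parentFun r) (T.largeVertices r)).card := by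
  have hp := T.isParentFun r
  have hmem : ∀ σ : T.graph ≃g T.graph, σ ∈ T.autSmall r →
      σ.toEquiv ∈ fixingPerms (T.parentFun r) (T.largeVertices r) := by
    rintro σ ⟨hσ, hσ'⟩
    rw [mem_fixingPerms]
    refine ⟨fun x => ?_, fun x hx => ?_⟩
    · by_cases hx : x = r
      · rw [hx, hp.root]
        change σ r = T.parentFun r (σ r)
        rw [hσ, hp.root]
      · refine map_parent_of_adj (f := σ) (u := r) (w := r) hp hp hσ
          (fun x _ => hp.isBelow_root (Finset.mem_univ _)) (fun x y _ _ h => σ.injective h)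
          (fun x y _ _ h => ?_) (hp.isBelow_root (Finset.mem_univ x)) hx
        rw [parentGraph_parentFun] at h ⊢
        exact σ.map_adj_iff.2 h
    · classical
      rw [largeVertices, Finset.mem_filter] at hx
      rcases hx.2 with rfl | hx
      · exact hσ
      · exact hσ' x hx
  have hiso : ∀ σ ∈ fixingPerms (T.parentFun r) (T.largeVertices r), ∀ x y,
      T.graph.Adj (σ x) (σ y) ↔ T.graph.Adj x y := by
    intro σ hσ x y
    have h := isFringeIso_of_perm (mem_fixingPerms.1 hσ).1 r
    have := h.adj_iff hp hp (hp.isBelow_root (Finset.mem_univ x))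
      (hp.isBelow_root (Finset.mem_univ y))
    rwa [parentGraph_parentFun] at this
  let e : T.autSmall r ≃ fixingPerms (T.parentFun r) (T.largeVertices r) :=
    { toFun := fun σ => ⟨σ.1.toEquiv, hmem σ.1 σ.2⟩
      invFun := fun σ => ⟨⟨σ.1, fun {x y} => hiso σ.1 σ.2 x y⟩,
        (mem_fixingPerms.1 σ.2).2 r (T.mem_largeVertices.2 (.inl rfl)), fun v hv =>
          (mem_fixingPerms.1 σ.2).2 v
            (T.mem_largeVertices.2 (.inr (T.isLargeBranchRoot_iff.1 hv).2))⟩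
      left_inv := fun _ => rfl
      right_inv := fun _ => rfl }
  rw [Nat.card_congr e, Nat.card_eq_fintype_card, Fintype.card_coe]

/-- Fringe subtrees grow towards the root, so `largeVertices` is closed under parents and
`card_fixingPerms` applies; the children outside it are exactly the roots of small branches. -/
theorem logAutSmall_eq (T : LabelledTree n) (r : Fin n) :
    T.logAutSmall r = ∑ i : Fin n, ∑ x ∈ smallTypes n,
      Real.log ((T.branchCount r i x.2).factorial : ℝ) := by
  classical
  have hp := T.isParentFun r
  rw [logAutSmall, card_autSmall, card_fixingPerms (τ := T.branchType r) (s := smallTypes n) hp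
    (fun v w => T.branchType_eq_iff T)]
  · push_cast
    rw [Real.log_prod (fun i _ => Finset.prod_ne_zero_iff.2 fun x _ => by positivity)]
    refine Finset.sum_congr rfl fun i _ => ?_
    rw [Real.log_prod (fun x _ => by positivity)]
    refine Finset.sum_congr rfl fun x hx => ?_
    rw [branchCount_eq]
    refine congrArg (fun k : ℕ => Real.log (k.factorial : ℝ))
      (congrArg Finset.card (Finset.ext fun v => ?_))
    simp only [Finset.mem_filter, Finset.mem_univ, true_and]
    refine and_congr_left ?_
    rintro ⟨_, rfl⟩
    rw [branchType_mem_smallTypes_iff] at hx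
    rw [mem_largeVertices, not_or]
    constructor
    · exact fun h => hp.parent_ne (Finset.mem_univ v) h.1
    · refine fun h => ⟨?_, not_lt.2 hx⟩
      rintro rfl
      exact h hp.root
  · exact T.mem_largeVertices.2 (.inl rfl)
  · intro x hx
    rw [mem_largeVertices] at hx ⊢
    rcases hx with rfl | hx
    · exact .inl hp.root
    · refine .inr (hx.trans_le ?_)
      exact_mod_cast Finset.card_le_card (fringe_subset (isBelow_parent _ _))
  · intro v hv
    rw [mem_largeVertices, not_or, not_lt] at hv
    exact T.branchType_mem_smallTypes_iff.2 hv.2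

end LabelledTree

/-! ### Sums of log-factorials when one element changes its type. -/

section FibreSums

variable {α X : Type} [DecidableEq α] [DecidableEq X]

theorem log_factorial_nonneg (k : ℕ) : 0 ≤ Real.log (k.factorial : ℝ) := Real.log_natCast_nonneg _

theorem log_factorial_mono {k m : ℕ} (h : k ≤ m) :
    Real.log (k.factorial : ℝ) ≤ Real.log (m.factorial : ℝ) :=
  Real.log_le_log (by positivity) (by exact_mod_cast Nat.factorial_le h)

theorem log_factorial_of_le_one {k : ℕ} (h : k ≤ 1) : Real.log (k.factorial : ℝ) = 0 := by
  rw [Nat.factorial_eq_one.2 h, Nat.cast_one, Real.log_one]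

/-- From k + 1 ≤ 2 ^ k. The bound is linear in `k`, so it can be charged to the twins one by one. -/
theorem log_factorial_succ_le (k : ℕ) :
    Real.log ((k + 1).factorial : ℝ) ≤ Real.log (k.factorial : ℝ) + Real.log 2 * k := by
  rw [Nat.factorial_succ, Nat.cast_mul, Real.log_mul (by positivity) (by positivity), add_comm]
  have h : ((k + 1 : ℕ) : ℝ) ≤ (2 : ℝ) ^ k := by exact_mod_cast Nat.lt_two_pow_self
  have := Real.log_le_log (by positivity) h
  rw [Real.log_pow] at this
  linarith

/-- Changing the type of one element `u` decreases the sum of the logarithms of the factorials of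
the fibre sizes by at most `log 2` for each other element of the type of `u`. -/
theorem sum_log_factorial_fibre_le (C : Finset α) (s : Finset X) (τ τ' : α → X) (u : α)
    (h : ∀ x ∈ C, x ≠ u → τ' x = τ x) :
    ∑ B ∈ s, Real.log ((C.filter fun x => τ x = B).card.factorial : ℝ) ≤
      ∑ B ∈ s, Real.log ((C.filter fun x => τ' x = B).card.factorial : ℝ) +
        Real.log 2 * (C.filter fun x => x ≠ u ∧ τ x = τ u).card := by
  set M := (C.filter fun x => x ≠ u ∧ τ x = τ u).card with hM
  have h2 : 0 ≤ Real.log 2 * M := mul_nonneg (Real.log_nonneg one_le_two) (Nat.cast_nonneg M)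
  have hB : ∀ B ∈ s, Real.log ((C.filter fun x => τ x = B).card.factorial : ℝ) ≤
      Real.log ((C.filter fun x => τ' x = B).card.factorial : ℝ) +
        if B = τ u then Real.log 2 * M else 0 := by
    intro B _
    split_ifs with hBu
    · have h3 : (C.filter fun x => τ x = B).card ≤ M + 1 := by
        rw [hM]
        refine le_trans (Finset.card_le_card (t := insert u
          (C.filter fun x => x ≠ u ∧ τ x = τ u)) ?_) (Finset.card_insert_le _ _)
        intro x hx
        rw [Finset.mem_filter] at hx
        rw [Finset.mem_insert, Finset.mem_filter]
        by_cases hxu : x = u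
        · exact .inl hxu
        · exact .inr ⟨hx.1, hxu, hx.2.trans hBu⟩
      have h4 : M ≤ (C.filter fun x => τ' x = B).card := by
        refine Finset.card_le_card fun x hx => ?_
        rw [Finset.mem_filter] at hx ⊢
        exact ⟨hx.1, by rw [h x hx.1 hx.2.1, hx.2.2, hBu]⟩
      have := log_factorial_mono h3
      have := log_factorial_mono h4
      have := log_factorial_succ_le M
      linarith
    · rw [add_zero]
      refine log_factorial_mono (Finset.card_le_card fun x hx => ?_)
      rw [Finset.mem_filter] at hx ⊢
      refine ⟨hx.1, ?_⟩
      rw [h x hx.1 fun hxu => hBu (by rw [← hx.2, hxu]), hx.2]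
  refine (Finset.sum_le_sum hB).trans ?_
  rw [Finset.sum_add_distrib, Finset.sum_ite_eq']
  gcongr
  split_ifs
  · exact le_rfl
  · exact h2

end FibreSums

/-! ### The effect of one bend on the parameter. -/

section BendPath

variable {V : Type} {W S : Finset V} {r u v w x y a b : V} {p q f g : V → V}

theorem IsPathSlot.eq_or_isBelow (h : IsPathSlot p v a b) (hb : IsBelow p x b) :
    x = b ∨ x = a ∨ IsBelow p x v := by
  by_cases hxb : b = x
  · exact .inl hxb.symm
  · have h1 := hb.parent_of_ne hxb
    rw [h.parent_b] at h1
    by_cases hxa : a = x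
    · exact .inr (.inl hxa.symm)
    · have h2 := h1.parent_of_ne hxa
      rw [h.parent_a] at h2
      exact .inr (.inr h2)

/-- Bending a path changes only the fringe subtrees at vertices above it. -/
theorem IsPathSlot.isFringeIso_bendPath [DecidableEq V] (h : IsPathSlot p v a b)
    (hx : ¬ IsBelow p x v) (hxa : x ≠ a) : IsFringeIso p (bendPath p (v, a, b)) x x id := by
  have hq : ∀ y, y ≠ b → bendPath p (v, a, b) y = p y := fun y hy => Function.update_of_ne hy _ _
  have hqb : bendPath p (v, a, b) b = v := Function.update_self _ _ _
  refine ⟨rfl, fun y hy hyx => ?_, fun _ _ _ _ h => h, fun y hy => ⟨y, ?_, rfl⟩⟩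
  · refine (hq y ?_).symm
    rintro rfl
    rcases h.eq_or_isBelow hy with h1 | h1 | h1
    · exact hyx h1.symm
    · exact hxa h1
    · exact hx h1
  · refine hy.induction (P := fun y => IsBelow p x y) (.refl _ _) ?_
    intro y _ _ h2
    by_cases hyb : y = b
    · rw [hyb, hqb] at h2
      exact absurd h2 hx
    · rw [hq y hyb] at h2
      exact h2.trans (isBelow_parent p y)

theorem isBelow_iff_eq_of_leaf (h : ∀ x, p x ≠ a) : IsBelow p a x ↔ x = a := by
  constructor
  · rintro ⟨k, hk⟩
    cases k with
    | zero => exact hk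
    | succ k =>
      rw [Function.iterate_succ_apply'] at hk
      exact absurd hk (h _)
  · rintro rfl
    exact .refl _ _

theorem IsCherrySlot.isFringeIso (h : IsCherrySlot p v a b) : IsFringeIso p p a b fun _ => b := by
  have ha : ∀ x, IsBelow p a x → x = a := fun x => (isBelow_iff_eq_of_leaf h.parent_ne_a).1
  refine ⟨rfl, fun x hx hxa => absurd (ha x hx) hxa, fun x y hx hy _ => (ha x hx).trans
    (ha y hy).symm, fun y hy => ⟨a, .refl _ _, ?_⟩⟩
  exact ((isBelow_iff_eq_of_leaf h.parent_ne_b).1 hy).symm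

end BendPath

namespace LabelledTree

variable {n : ℕ} {r i v w : Fin n}

/-- The contribution of the vertex `i` to `logAutSmall`. -/
noncomputable def vertexTerm (T : LabelledTree n) (r i : Fin n) : ℝ :=
  ∑ x ∈ smallTypes n, Real.log ((T.branchCount r i x.2).factorial : ℝ)

open Classical in
/-- The children of `i`. -/
noncomputable def children (T : LabelledTree n) (r i : Fin n) : Finset (Fin n) :=
  Finset.univ.filter fun v => T.parentFun r v ≠ v ∧ T.parentFun r v = i

theorem mem_children (T : LabelledTree n) :
    v ∈ T.children r i ↔ T.parentFun r v ≠ v ∧ T.parentFun r v = i := by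
  classical simp [children]

open Classical in
theorem branchCount_eq_card_filter_children (T : LabelledTree n)
    (x : Σ m, UnlabelledRootedTree m) :
    T.branchCount r i x.2 = ((T.children r i).filter fun v => T.branchType r v = x).card := by
  rw [branchCount_eq, children, Finset.filter_filter]
  simp only [and_assoc]

theorem vertexTerm_nonneg (T : LabelledTree n) (r i : Fin n) : 0 ≤ T.vertexTerm r i :=
  Finset.sum_nonneg fun _ _ => log_factorial_nonneg _

theorem vertexTerm_eq_zero (T : LabelledTree n) (h : (T.children r i).card ≤ 1) :
    T.vertexTerm r i = 0 := by
  classical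
  refine Finset.sum_eq_zero fun x _ => log_factorial_of_le_one ?_
  rw [branchCount_eq_card_filter_children]
  exact (Finset.card_filter_le _ _).trans h

theorem log_two_le_vertexTerm (T : LabelledTree n) {a b : Fin n} (hn : 2 ≤ n)
    (h : IsCherrySlot (T.parentFun r) v a b) : Real.log 2 ≤ T.vertexTerm r v := by
  classical
  -- This makes a single leaf a small branch, so that the cherry is counted.
  have hlog : (1 : ℝ) ≤ 4 * Real.log n := by
    have h1 := Real.log_two_gt_d9
    have h2 : Real.log 2 ≤ Real.log n :=
      Real.log_le_log two_pos (by exact_mod_cast hn)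
    linarith
  have ha : fringe (T.parentFun r) a = {a} := by
    ext x
    rw [mem_fringe, isBelow_iff_eq_of_leaf h.parent_ne_a, Finset.mem_singleton]
  have hmem : T.branchType r a ∈ smallTypes n := by
    rw [branchType_mem_smallTypes_iff, ha, Finset.card_singleton, Nat.cast_one]
    exact hlog
  have hb : T.branchType r b = T.branchType r a :=
    ((T.branchType_eq_iff T).2 ⟨_, h.isFringeIso⟩).symm
  have hcount : 2 ≤ T.branchCount r v (T.branchType r a).2 := by
    rw [branchCount_eq_card_filter_children, ← Finset.card_pair h.ne_ab]
    refine Finset.card_le_card fun x hx => ?_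
    rw [Finset.mem_filter, mem_children]
    simp only [Finset.mem_insert, Finset.mem_singleton] at hx
    rcases hx with rfl | rfl
    · exact ⟨⟨by rw [h.parent_a]; exact h.ne_va, h.parent_a⟩, rfl⟩
    · exact ⟨⟨by rw [h.parent_b]; exact h.ne_vb, h.parent_b⟩, hb⟩
  have h1 := log_factorial_mono hcount
  rw [Nat.factorial_two, Nat.cast_two] at h1
  exact h1.trans (Finset.single_le_sum
    (f := fun x : Σ m, UnlabelledRootedTree m =>
      Real.log ((T.branchCount r v x.2).factorial : ℝ))
    (fun _ _ => log_factorial_nonneg _) hmem)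

-- At `v` two isomorphic leaves appear where there was a single child, and `a` had only one child to
-- lose. At any other `i` the children stay the same and at most one of them, the one above `v`,
-- changes type; the loss is charged to its twins.
open Classical in
theorem vertexTerm_le_of_bendPath (T U : LabelledTree n) {a b : Fin n} (hn : 2 ≤ n)
    (h : IsPathSlot (T.parentFun r) v a b)
    (hU : U.parentFun r = bendPath (T.parentFun r) (v, a, b)) (i : Fin n) :
    T.vertexTerm r i + (if i = v then Real.log 2 else 0) ≤ U.vertexTerm r i +
      Real.log 2 * ∑ u with (T.parentFun r u ≠ u ∧ IsBelow (T.parentFun r) u v) ∧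
        T.parentFun r u = i, ((twins (T.parentFun r) u).card : ℝ) := by
  have hp := T.isParentFun r
  have hsum : 0 ≤ Real.log 2 * ∑ u with (T.parentFun r u ≠ u ∧ IsBelow (T.parentFun r) u v) ∧
      T.parentFun r u = i, ((twins (T.parentFun r) u).card : ℝ) :=
    mul_nonneg (Real.log_nonneg one_le_two) (Finset.sum_nonneg fun _ _ => Nat.cast_nonneg _)
  by_cases hiv : i = v
  · subst hiv
    have h1 : T.vertexTerm r i = 0 := by
      refine vertexTerm_eq_zero T (Finset.card_le_one.2 fun x hx y hy => ?_)
      rw [mem_children] at hx hy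
      rw [h.of_parent_eq_v x hx.2, h.of_parent_eq_v y hy.2]
    have h2 := U.log_two_le_vertexTerm hn (by rw [hU]; exact h.isCherrySlot_update)
    rw [h1, if_pos rfl]
    linarith
  rw [if_neg hiv, add_zero]
  by_cases hia : i = a
  · subst hia
    have h1 : T.vertexTerm r i = 0 := by
      refine vertexTerm_eq_zero T (Finset.card_le_one.2 fun x hx y hy => ?_)
      rw [mem_children] at hx hy
      rw [h.of_parent_eq_a x hx.2, h.of_parent_eq_a y hy.2]
    have h2 := U.vertexTerm_nonneg r i
    rw [h1]
    linarith
  have hch : U.children r i = T.children r i := by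
    ext x
    rw [mem_children, mem_children, hU]
    by_cases hxb : x = b
    · subst hxb
      rw [bendPath, Function.update_self, h.parent_b]
      constructor
      · exact fun h => absurd h.2.symm hiv
      · exact fun h => absurd h.2.symm hia
    · rw [bendPath, Function.update_of_ne hxb]
  have htype : ∀ x ∈ T.children r i, ¬ IsBelow (T.parentFun r) x v →
      U.branchType r x = T.branchType r x := by
    intro x hx hxv
    refine ((T.branchType_eq_iff U).2 ⟨id, ?_⟩).symm
    rw [hU]
    refine h.isFringeIso_bendPath hxv ?_
    rintro rfl
    rw [mem_children, h.parent_a] at hx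
    exact hiv hx.2.symm
  simp only [vertexTerm, branchCount_eq_card_filter_children, hch]
  by_cases hex : ∃ u ∈ T.children r i, IsBelow (T.parentFun r) u v
  · obtain ⟨u, hu, huv⟩ := hex
    have hu' := (mem_children T).1 hu
    refine (sum_log_factorial_fibre_le (T.children r i) (smallTypes n) (T.branchType r)
      (U.branchType r) u ?_).trans ?_
    · intro x hx hxu
      refine htype x hx fun hxv => ?_
      have hx' := (mem_children T).1 hx
      exact hp.disjoint_of_siblings hx'.1 hu'.1 hxu (hx'.2.trans hu'.2.symm) ⟨hxv, huv⟩
    · refine add_le_add le_rfl (mul_le_mul_of_nonneg_left ?_ (Real.log_nonneg one_le_two))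
      have h3 : ((T.children r i).filter fun x =>
          x ≠ u ∧ T.branchType r x = T.branchType r u).card ≤ (twins (T.parentFun r) u).card := by
        refine Finset.card_le_card fun x hx => ?_
        rw [Finset.mem_filter, mem_children] at hx
        obtain ⟨f, hf⟩ := (T.branchType_eq_iff T).1 hx.2.2.symm
        exact mem_twins.2 ⟨hx.2.1, hx.1.1, hx.1.2.trans hu'.2.symm, f, hf⟩
      refine (Nat.cast_le.2 h3).trans ?_
      exact Finset.single_le_sum (f := fun u => ((twins (T.parentFun r) u).card : ℝ))
        (fun _ _ => Nat.cast_nonneg _)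
        (Finset.mem_filter.2 ⟨Finset.mem_univ u, ⟨hu'.1, huv⟩, hu'.2⟩)
  · push Not at hex
    refine le_trans (le_of_eq ?_) (le_add_of_nonneg_right hsum)
    refine Finset.sum_congr rfl fun x _ => ?_
    congr 4
    refine Finset.filter_congr fun y hy => ?_
    rw [htype y hy (hex y hy)]

-- Sum the local bounds over `i`: each `u` above `v` is charged at its parent only.
open Classical in
theorem logAutSmall_bendPath (T U : LabelledTree n) {a b : Fin n} (hn : 2 ≤ n)
    (h : IsPathSlot (T.parentFun r) v a b)
    (hU : U.parentFun r = bendPath (T.parentFun r) (v, a, b)) :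
    T.logAutSmall r + Real.log 2 ≤ U.logAutSmall r +
      Real.log 2 * ∑ u with T.parentFun r u ≠ u ∧ IsBelow (T.parentFun r) u v,
        ((twins (T.parentFun r) u).card : ℝ) := by
  have h1 := Finset.sum_le_sum fun i (_ : i ∈ Finset.univ) =>
    vertexTerm_le_of_bendPath T U hn h hU i
  rw [Finset.sum_add_distrib, Finset.sum_add_distrib, Finset.sum_ite_eq', if_pos
    (Finset.mem_univ v), ← Finset.mul_sum] at h1
  simp only [← Finset.filter_filter] at h1
  rw [Finset.sum_fiberwise] at h1
  simp only [Finset.filter_filter] at h1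
  rw [logAutSmall_eq, logAutSmall_eq]
  exact h1

end LabelledTree

/-! ### Cauchy–Schwarz and the variance bound. -/

namespace LabelledTree

variable {n : ℕ}

instance (n : ℕ) : DiscreteMeasurableSpace (LabelledTree n) := ⟨fun _ => trivial⟩

theorem sum_eq_sum_parentFuns [Fintype (LabelledTree n)] (r : Fin n) (K : (Fin n → Fin n) → ℝ) :
    ∑ T : LabelledTree n, K (T.parentFun r) =
      ∑ p ∈ parentFuns (Finset.univ : Finset (Fin n)) r, K p := by
  rw [← Finset.sum_coe_sort (parentFuns (Finset.univ : Finset (Fin n)) r) K]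
  exact Equiv.sum_comp (equivParentFuns r) fun p : {p // p ∈ parentFuns Finset.univ r} => K p

theorem card_mul_variance [Fintype (LabelledTree n)] [Nonempty (LabelledTree n)]
    (F : LabelledTree n → ℝ) :
    Fintype.card (LabelledTree n) * variance F (uniformTree n) =
      ∑ T, (F T - ∫ U, F U ∂uniformTree n) ^ 2 := by
  have hprob : IsProbabilityMeasure (uniformTree n) :=
    isProbabilityMeasure_uniformOn Set.finite_univ Set.univ_nonempty
  rw [variance_eq_integral (Measurable.of_discrete).aemeasurable, integral_fintype .of_finite,
    Finset.mul_sum]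
  refine Finset.sum_congr rfl fun T _ => ?_
  have : (uniformTree n).real {T} = (Fintype.card (LabelledTree n) : ℝ)⁻¹ := by
    rw [measureReal_def, uniformTree, uniformOn_univ, Measure.count_singleton]
    simp
  rw [this, smul_eq_mul, mul_inv_cancel_left₀]
  exact_mod_cast Fintype.card_ne_zero

theorem card_eq [Fintype (LabelledTree n)] (r : Fin n) :
    Fintype.card (LabelledTree n) = n ^ (n - 2) := by
  rw [Fintype.card_congr (equivParentFuns r), Fintype.card_coe,
    card_parentFuns (Finset.mem_univ r), Finset.card_univ, Fintype.card_fin]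

/-- Apply `sum_mul_slotBalance` to the statistic itself, which every bend raises by 3. -/
theorem sum_slotBalance_sq (r : Fin n) :
    ∑ p ∈ parentFuns (Finset.univ : Finset (Fin n)) r, slotBalance p ^ 2 = 3 * pathTotal n := by
  simp only [sq]
  rw [sum_mul_slotBalance]
  have h : ∀ p ∈ parentFuns (Finset.univ : Finset (Fin n)) r, ∑ t ∈ pathSlots p,
      (slotBalance (bendPath p t) - slotBalance p) = 3 * (pathSlots p).card := by
    intro p _
    rw [Finset.sum_congr rfl fun t ht => slotBalance_bendPath ht, Finset.sum_const, nsmul_eq_mul,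
      mul_comm]
  rw [Finset.sum_congr rfl h, ← Finset.mul_sum, ← Nat.cast_sum,
    sum_card_pathSlots (Finset.mem_univ r), Finset.card_univ, Fintype.card_fin]

/-- Every path contributes log 2 minus its twin charges, and all charges together take at most a
quarter of the total. The constant `c` cancels in the increments. -/
theorem le_sum_mul_slotBalance (hn : 2 ≤ n) (r : Fin n) (G : (Fin n → Fin n) → ℝ) (c : ℝ)
    (hG : ∀ T : LabelledTree n, G (T.parentFun r) = T.logAutSmall r - c) :
    Real.log 2 * (3 / 4 * pathTotal n) ≤
      ∑ p ∈ parentFuns (Finset.univ : Finset (Fin n)) r, G p * slotBalance p := by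
  classical
  have hrep : ∀ p ∈ parentFuns (Finset.univ : Finset (Fin n)) r,
      ∃ T : LabelledTree n, T.parentFun r = p := fun p hp =>
    ⟨(equivParentFuns r).symm ⟨p, hp⟩, congrArg Subtype.val
      ((equivParentFuns r).apply_symm_apply ⟨p, hp⟩)⟩
  have h1 : ∀ p ∈ parentFuns (Finset.univ : Finset (Fin n)) r, ∀ t ∈ pathSlots p,
      Real.log 2 - Real.log 2 * ∑ u with p u ≠ u ∧ IsBelow p u t.1, ((twins p u).card : ℝ) ≤
        G (bendPath p t) - G p := by
    intro p hp t ht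
    have hs := mem_pathSlots.1 ht
    obtain ⟨U, hU⟩ := hrep (bendPath p t)
      (mem_parentFuns.2 (hs.isParentFun_update (mem_parentFuns.1 hp)))
    obtain ⟨T, rfl⟩ := hrep p hp
    have := logAutSmall_bendPath T U hn hs hU
    rw [← hU, hG, hG]
    linarith
  rw [sum_mul_slotBalance]
  refine le_trans ?_ (Finset.sum_le_sum fun p hp => Finset.sum_le_sum (h1 p hp))
  have h2 := four_mul_sum_card_twins_le r
  rw [Fintype.card_fin] at h2
  have h3 := sum_card_pathSlots (Finset.mem_univ r)
  rw [Finset.card_univ, Fintype.card_fin] at h3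
  simp only [Finset.sum_sub_distrib, Finset.sum_const, nsmul_eq_mul, ← Finset.mul_sum,
    ← Finset.sum_mul]
  rw [← Nat.cast_sum, h3]
  have := mul_le_mul_of_nonneg_left h2 (Real.log_nonneg one_le_two)
  linarith

theorem pathTotal_le_card_mul_variance (hn : 4 ≤ n) (r : Fin n) :
    9 / 100 * (pathTotal n : ℝ) ≤ (n ^ (n - 2) : ℕ) * variance (logAutSmall r) (uniformTree n) := by
  classical
  have : Fintype (LabelledTree n) := Fintype.ofFinite _
  have hne : Nonempty (LabelledTree n) := by
    rw [← Fintype.card_pos_iff, card_eq r]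
    positivity
  rw [← card_eq r, card_mul_variance]
  set c := ∫ U, logAutSmall r U ∂uniformTree n
  let G : (Fin n → Fin n) → ℝ := fun p =>
    if h : p ∈ parentFuns (Finset.univ : Finset (Fin n)) r then
      logAutSmall r ((equivParentFuns r).symm ⟨p, h⟩) - c else 0
  have hG : ∀ T : LabelledTree n, G (T.parentFun r) = T.logAutSmall r - c := by
    intro T
    have hT := mem_parentFuns.2 (T.isParentFun r)
    have : (equivParentFuns r).symm ⟨T.parentFun r, hT⟩ = T :=
      (equivParentFuns r).symm_apply_apply T
    simp only [G, dif_pos hT, this]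
  have h1 := le_sum_mul_slotBalance (by omega) r G c hG
  have h2 := Finset.sum_mul_sq_le_sq_mul_sq (parentFuns (Finset.univ : Finset (Fin n)) r) G
    slotBalance
  rw [sum_slotBalance_sq, ← sum_eq_sum_parentFuns r fun p => G p ^ 2] at h2
  simp only [hG] at h2
  set X := ∑ T : LabelledTree n, (T.logAutSmall r - c) ^ 2
  have hlog := Real.log_two_gt_d9
  have hP : 0 < (pathTotal n : ℝ) := by
    have h1 : 0 < n - 1 := by omega
    have h2 : 0 < n - 2 := by omega
    have h3 : 0 < n - 3 := by omega
    have : 0 < pathTotal n := by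
      rw [pathTotal]
      positivity
    exact_mod_cast this
  have h3 : (0.693 * (3 / 4 * (pathTotal n : ℝ))) ^ 2 ≤ X * (3 * pathTotal n) := by
    refine le_trans (pow_le_pow_left₀ (by positivity) (le_trans ?_ h1) 2) h2
    exact mul_le_mul_of_nonneg_right (by linarith) (by positivity)
  -- The margin is thin: (0.693 · 3/4)² / 3 is about 0.09005.
  have h4 : 9 / 100 * (pathTotal n : ℝ) * (3 * pathTotal n) ≤ X * (3 * pathTotal n) := by
    refine le_trans ?_ h3
    nlinarith [sq_nonneg (pathTotal n : ℝ)]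
  exact le_of_mul_le_mul_right h4 (by positivity)

/-- The quotient of `pathTotal n` by n ^ (n - 1) is at least (1 - 3/n) ^ (n - 1), which tends to
e⁻³, about 0.0498. -/
theorem eventually_le_pathTotal :
    ∀ᶠ n : ℕ in atTop, (n : ℝ) * (n ^ (n - 2) : ℕ) ≤ 40 * pathTotal n := by
  have hexp : (1 / 40 : ℝ) < Real.exp (-3) := by
    have h1 := Real.exp_one_lt_d9
    have h2 : Real.exp 3 = Real.exp 1 ^ 3 := by rw [← Real.exp_nat_mul]; norm_num
    have h3 : Real.exp 1 ^ 3 ≤ 2.72 ^ 3 :=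
      pow_le_pow_left₀ (Real.exp_pos 1).le (by linarith) 3
    rw [Real.exp_neg, h2, one_div]
    exact inv_strictAnti₀ (by positivity) (lt_of_le_of_lt h3 (by norm_num))
  have hlim := (Real.tendsto_one_add_div_pow_exp (-3)).eventually (lt_mem_nhds hexp)
  filter_upwards [hlim, eventually_ge_atTop 5] with n hn h5
  obtain ⟨m, rfl⟩ : ∃ m, n = m + 4 := ⟨n - 4, by omega⟩
  simp only [pathTotal, show m + 4 - 1 = m + 3 by omega, show m + 4 - 2 = m + 2 by omega,
    show m + 4 - 3 = m + 1 by omega, show m + 4 - 4 = m by omega]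
  push_cast at hn ⊢
  have hm : (0 : ℝ) < (m : ℝ) + 4 := by positivity
  have e : 1 + -3 / ((m : ℝ) + 4) = (m + 1) / (m + 4) := by
    field_simp
    ring
  rw [e] at hn
  have hle : ((m : ℝ) + 1) / (m + 4) ≤ 1 := by
    rw [div_le_one hm]
    linarith
  have hpow : (((m : ℝ) + 1) / (m + 4)) ^ (m + 4) ≤ (((m : ℝ) + 1) / (m + 4)) ^ (m + 3) :=
    pow_le_pow_of_le_one (by positivity) hle (by omega)
  have h6 : 1 / 40 ≤ ((m : ℝ) + 1) ^ (m + 3) / (m + 4) ^ (m + 3) := by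
    rw [← div_pow]
    exact hn.le.trans hpow
  rw [le_div_iff₀ (by positivity)] at h6
  have h7 : ((m : ℝ) + 1) ^ (m + 3) ≤ (m + 3) * (m + 2) * (m + 1) * (m + 1) ^ m := by
    have : ((m : ℝ) + 1) * (m + 1) * (m + 1) * (m + 1) ^ m = (m + 1) ^ (m + 3) := by ring
    rw [← this]
    have h0 : (0 : ℝ) ≤ m := Nat.cast_nonneg m
    gcongr <;> linarith
  calc ((m : ℝ) + 4) * (m + 4) ^ (m + 2) = (m + 4) ^ (m + 3) := by ring
    _ ≤ _ := by linarith

end LabelledTree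

theorem mainTheorem10 :
    (∀ (n : ℕ) (r : Fin n) (T : LabelledTree n),
      T.logAutSmall r =
        ∑ i : Fin n, ∑ m ∈ Finset.Icc 1 ⌊4 * Real.log n⌋₊, ∑ B : UnlabelledRootedTree m,
          Real.log ((T.branchCount r i B).factorial : ℝ)) ∧
    (∀ᶠ n : ℕ in atTop, ∀ r : Fin n,
      0.002 * (n : ℝ) ≤ variance (LabelledTree.logAutSmall r) (uniformTree n)) := by
  constructor
  · intro n r T
    rw [T.logAutSmall_eq r]
    refine Finset.sum_congr rfl fun i _ => ?_
    rw [LabelledTree.smallTypes, Finset.sum_sigma]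
  · filter_upwards [LabelledTree.eventually_le_pathTotal, eventually_ge_atTop 4] with n h1 hn r
    have h2 := LabelledTree.pathTotal_le_card_mul_variance hn r
    have hpos : (0 : ℝ) < (n ^ (n - 2) : ℕ) := by
      have : 0 < n := by omega
      positivity
    -- The constants combine to 9/100 · 1/40 = 0.00225.
    refine le_of_mul_le_mul_left ?_ hpos
    refine le_trans ?_ h2
    have h3 : (0 : ℝ) ≤ (n : ℝ) * (n ^ (n - 2) : ℕ) := by positivity
    linarith
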